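/- \textbf{Setting.} Let $\mathcal C$ be a braided monoidal category with braiding $\Psi$, unit object $\mathbf 1$ (associativity and unit isomorphisms are suppressed), in which every object $X$ has duals $X^\vee$ and ${}^\vee X$, with evaluations $\mathrm{ev}:X\otimes X^\vee\to\mathbf 1$, ${\rm ev}:{}^\vee X\otimes X\to\mathbf 1$ and coevaluations $\mathrm{coev}:\mathbf 1\to X^\vee\otimes X$, $\mathrm{coev}:\mathbf 1\to X\otimes{}^\vee X$ satisfying the zig-zag identities, and in which every idempotent splits. Transposes of $f:X\to Y$ are written $f^t:Y^\vee\to X^\vee$ and ${}^tf:{}^\vee Y\to{}^\vee X$. For $f:X\to X$ put $$\mathrm{tr}_8(f)=\bigl(\mathbf 1\xrightarrow{\rm coev}X\otimes{}^\vee X\xrightarrow{f\otimes 1}X\otimes{}^\vee X\xrightarrow{\Psi}{}^\vee X\otimes X\xrightarrow{\rm ev}\mathbf 1\bigr),\qquad \dim_8(X)=\mathrm{tr}_8(\mathrm{id}_X).$$ For $c\in\mathrm{End}(\mathbf 1)$ and a morphism $f$, $c\cdot f:=c\otimes f$. An object $K$ is invertible if $K\otimes L\simeq\mathbf 1\simeq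 L\otimes K$ for some object $L$. Let $(H,\mu,\eta,\Delta,\varepsilon,S)$ be a Hopf algebra in $\mathcal C$ with invertible antipode $S$. A morphism $f:H\to X$ is a left (right) $X$-valued integral on $H$ if $(1_H\otimes f)\Delta=\eta\otimes f$ (resp. $(f\otimes 1_H)\Delta=f\otimes\eta$). A morphism $f:X\to H$ is a left (right) $X$-based integral in $H$ if $\mu(1_H\otimes f)=\varepsilon\otimes f$ (resp. $\mu(f\otimes 1_H)=f\otimes\varepsilon$). An object of integrals of $H$ is an object $\int H$ with a left and a right integral on $H$, $\int^\ell_{\rm on},\int^r_{\rm on}:H\to\int H$, and a left and a right integral in $H$, $\int^\ell_{\rm in},\int^r_{\rm in}:\int H\to H$, each universal: every left (right) $X$-valued integral on $H$ factors uniquely as $g\circ\int^\ell_{\rm on}$ (resp. $g\circ\int^r_{\rm on}$) with $g:\int H\to X$, and every left (right) $X$-based integral in $H$ factors uniquely as $\int^\ell_{\rm in}\circ h$ (resp. $\int^r_{\rm in}\circ h$) with $h:X\to\int H$. Define endomorphisms of $H$ by \begin{align*} \check\Pi^r_\ell&=(1_H\otimes{\rm ev})\,(\Delta\otimes 1_{H^\vee})\,\Psi_{H^\vee,H}\,((S^2)^t\otimes\mu)\,({\rm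 coev}\otimes 1_H),\\ \check\Pi^\ell_r&=({\rm ev}\otimes 1_H)\,(1_{{}^\vee H}\otimes\Delta)\,\Psi_{H,{}^\vee H}\,(\mu\otimes{}^t(S^2))\,(1_H\otimes{\rm coev}),\\ \check\Pi^\ell_\ell&=({\rm ev}\otimes{\rm ev}\otimes 1_H)\,(S^{-2}\otimes\Psi_{{}^\vee H,H^\vee}\otimes\Delta\mu)\,({\rm coev}\otimes{\rm coev}\otimes 1_H),\\ \check\Pi^r_r&=(1_H\otimes{\rm ev}\otimes{\rm ev})\,(\Delta\mu\otimes\Psi_{{}^\vee H,H^\vee}\otimes S^{-2})\,(1_H\otimes{\rm coev}\otimes{\rm coev}), \end{align*} where in the last two lines the coevaluations are $\mathbf 1\to H\otimes{}^\vee H$ and $\mathbf 1\to H^\vee\otimes H$, and the evaluations are $H\otimes H^\vee\to\mathbf 1$ and ${}^\vee H\otimes H\to\mathbf 1$, in this order. \textbf{Theorem.} An object of integrals $\int H$ of $H$ exists, and for every object of integrals $\int H$ of $H$ (with its four integrals) the following hold. (1) $\int H$ is invertible, and the four composites $\int^a_{\rm on}\circ\int^b_{\rm in}\in\mathrm{End}(\int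 H)$, $a,b\in\{\ell,r\}$, are invertible. There are invertible $c^a_b\in\mathrm{End}(\mathbf 1)$ with $\int^a_{\rm on}\circ\int^b_{\rm in}=c^a_b\cdot\mathrm{id}_{\int H}$ for all $a,b\in\{\ell,r\}$, and with these scalars $$(c^a_b)^{-1}\cdot\textstyle\int^b_{\rm in}\circ\int^a_{\rm on}=\check\Pi^a_b\qquad(a,b\in\{\ell,r\}),$$ so that $\check\Pi^a_b$ is an idempotent, split by $\int H$ through the morphisms $(c^a_b)^{-1}\cdot\int^a_{\rm on}:H\to\int H$ and $\int^b_{\rm in}:\int H\to H$, whose composite on $\int H$ is the identity. (2) $\check\Pi^r_\ell$ is a right $H$-valued integral on $H$ and a left $H$-based integral in $H$; $\check\Pi^\ell_r$ is a left $H$-valued integral on $H$ and a right $H$-based integral in $H$; $\check\Pi^\ell_\ell$ is a left $H$-valued integral on $H$ and a left $H$-based integral in $H$; $\check\Pi^r_r$ is a right $H$-valued integral on $H$ and a right $H$-based integral in $H$. (3) $\mathrm{tr}_8(\check\Pi^a_b)=\dim_8(\int H)$ for all $a,b\in\{\ell,r\}$. -/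

import Mathlib

open CategoryTheory MonoidalCategory
open scoped MonObj ComonObj HopfObj

universe v u

namespace BraidedIntegral

noncomputable section

variable {C : Type u} [Category.{v} C] [MonoidalCategory C]

/-- An object `K` is invertible if `K ⊗ L ≅ 𝟙` and `L ⊗ K ≅ 𝟙` for some object `L`. -/
def IsInvertibleObj (K : C) : Prop :=
  ∃ L : C, Nonempty (K ⊗ L ≅ 𝟙_ C) ∧ Nonempty (L ⊗ K ≅ 𝟙_ C)

/-- The action `c · f = c ⊗ f` of a scalar `c : 𝟙 ⟶ 𝟙` on a morphism `f : X ⟶ Y`,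
up to the unit isomorphisms `𝟙 ⊗ X ≅ X` and `𝟙 ⊗ Y ≅ Y`. -/
def scalar {X Y : C} (c : 𝟙_ C ⟶ 𝟙_ C) (f : X ⟶ Y) : X ⟶ Y :=
  (λ_ X).inv ≫ (c ⊗ₘ f) ≫ (λ_ Y).hom

/-! In Mathlib's notation `Xᘁ` comes with `η_ X Xᘁ : 𝟙 ⟶ X ⊗ Xᘁ` and `ε_ X Xᘁ : Xᘁ ⊗ X ⟶ 𝟙`
(this dual is often written `^∨X`), and `ᘁX` comes with `η_ (ᘁX) X : 𝟙 ⟶ ᘁX ⊗ X` and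
`ε_ (ᘁX) X : X ⊗ ᘁX ⟶ 𝟙` (often written `X^∨`). -/

section Trace

variable [BraidedCategory C] [RigidCategory C]

/-- The trace `𝟙 ⟶ X ⊗ Xᘁ ⟶ X ⊗ Xᘁ ⟶ Xᘁ ⊗ X ⟶ 𝟙`. -/
def tr8 {X : C} (f : X ⟶ X) : 𝟙_ C ⟶ 𝟙_ C :=
  η_ X Xᘁ ≫ f ▷ Xᘁ ≫ (β_ X Xᘁ).hom ≫ ε_ X Xᘁ

/-- The dimension associated to the trace `tr8`. -/
def dim8 (X : C) : 𝟙_ C ⟶ 𝟙_ C := tr8 (𝟙 X)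

end Trace

section Integrals

variable [BraidedCategory C] (H : C) [BimonObj H]

variable {H} in
/-- `f : H ⟶ X` is a left `X`-valued integral on `H`. -/
def IsLeftIntegralOn {X : C} (f : H ⟶ X) : Prop :=
  Δ[H] ≫ H ◁ f = f ≫ (λ_ X).inv ≫ η[H] ▷ X

variable {H} in
/-- `f : H ⟶ X` is a right `X`-valued integral on `H`. -/
def IsRightIntegralOn {X : C} (f : H ⟶ X) : Prop :=
  Δ[H] ≫ f ▷ H = f ≫ (ρ_ X).inv ≫ X ◁ η[H]

variable {H} in
/-- `f : X ⟶ H` is a left `X`-based integral in `H`. -/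
def IsLeftIntegralIn {X : C} (f : X ⟶ H) : Prop :=
  H ◁ f ≫ μ[H] = ε[H] ▷ X ≫ (λ_ X).hom ≫ f

variable {H} in
/-- `f : X ⟶ H` is a right `X`-based integral in `H`. -/
def IsRightIntegralIn {X : C} (f : X ⟶ H) : Prop :=
  f ▷ H ≫ μ[H] = X ◁ ε[H] ≫ (ρ_ X).hom ≫ f

/-- `K` is an object of integrals `∫H` of `H`, by means of a left integral `intL` on `H`, a right
integral `intR` on `H`, a left integral `cointL` in `H` and a right integral `cointR` in `H`,
each of which is universal among integrals of its kind. -/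
structure IsIntegralObj (K : C) (intL intR : H ⟶ K) (cointL cointR : K ⟶ H) : Prop where
  intL_isIntegral : IsLeftIntegralOn intL
  intR_isIntegral : IsRightIntegralOn intR
  cointL_isIntegral : IsLeftIntegralIn cointL
  cointR_isIntegral : IsRightIntegralIn cointR
  intL_universal : ∀ (X : C) (f : H ⟶ X), IsLeftIntegralOn f → ∃! g : K ⟶ X, intL ≫ g = f
  intR_universal : ∀ (X : C) (f : H ⟶ X), IsRightIntegralOn f → ∃! g : K ⟶ X, intR ≫ g = f
  cointL_universal : ∀ (X : C) (f : X ⟶ H), IsLeftIntegralIn f → ∃! h : X ⟶ K, h ≫ cointL = f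
  cointR_universal : ∀ (X : C) (f : X ⟶ H), IsRightIntegralIn f → ∃! h : X ⟶ K, h ≫ cointR = f

end Integrals

section Idempotents

variable [BraidedCategory C] [RigidCategory C] (H : C) [HopfObj H]

/-- The endomorphism `Π̌^r_ℓ(H)`:
`H ⟶ ᘁH ⊗ H ⊗ H ⟶ ᘁH ⊗ H ⟶ ᘁH ⊗ H ⟶ H ⊗ ᘁH ⟶ H ⊗ H ⊗ ᘁH ⟶ H`,
given by coevaluation, multiplication, the square of the antipode of the dual `ᘁH` (the transpose
of the square of the antipode of `H`), braiding, comultiplication and evaluation. -/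
def piRL : H ⟶ H :=
  𝟙 H ⊗≫ η_ (ᘁH : C) H ▷ H ⊗≫ (ᘁH : C) ◁ μ[H] ⊗≫ (ᘁ(𝒮[H] ≫ 𝒮[H])) ▷ H ⊗≫
    (β_ (ᘁH : C) H).hom ⊗≫ Δ[H] ▷ (ᘁH : C) ⊗≫ H ◁ ε_ (ᘁH : C) H ⊗≫ 𝟙 H

/-- The endomorphism `Π̌^ℓ_r(H)`:
`H ⟶ H ⊗ H ⊗ Hᘁ ⟶ H ⊗ Hᘁ ⟶ H ⊗ Hᘁ ⟶ Hᘁ ⊗ H ⟶ Hᘁ ⊗ H ⊗ H ⟶ H`,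
given by coevaluation, multiplication, the square of the antipode of the dual `Hᘁ` (the transpose
of the square of the antipode of `H`), braiding, comultiplication and evaluation. -/
def piLR : H ⟶ H :=
  𝟙 H ⊗≫ H ◁ η_ H (Hᘁ : C) ⊗≫ μ[H] ▷ (Hᘁ : C) ⊗≫ H ◁ ((𝒮[H] ≫ 𝒮[H])ᘁ) ⊗≫
    (β_ H (Hᘁ : C)).hom ⊗≫ (Hᘁ : C) ◁ Δ[H] ⊗≫ ε_ H (Hᘁ : C) ▷ H ⊗≫ 𝟙 H

/-- The endomorphism `Π̌^ℓ_ℓ(H)`: two coevaluations give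
`H ⟶ (H ⊗ Hᘁ) ⊗ (ᘁH ⊗ H) ⊗ H`; then `S⁻²` is applied to the first factor, the braiding
`Hᘁ ⊗ ᘁH ⟶ ᘁH ⊗ Hᘁ` to the second and third, multiplication followed by comultiplication to the
last two; two evaluations give `(H ⊗ ᘁH) ⊗ (Hᘁ ⊗ H) ⊗ H ⟶ H`. -/
def piLL [IsIso 𝒮[H]] : H ⟶ H :=
  𝟙 H ⊗≫ (η_ H (Hᘁ : C) ⊗ₘ η_ (ᘁH : C) H) ▷ H ⊗≫
    ((inv 𝒮[H] ≫ inv 𝒮[H]) ⊗ₘ (β_ (Hᘁ : C) (ᘁH : C)).hom ⊗ₘ (μ[H] ≫ Δ[H])) ⊗≫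
    (ε_ (ᘁH : C) H ⊗ₘ ε_ H (Hᘁ : C)) ▷ H ⊗≫ 𝟙 H

/-- The endomorphism `Π̌^r_r(H)`: two coevaluations give
`H ⟶ H ⊗ (H ⊗ Hᘁ) ⊗ (ᘁH ⊗ H)`; then multiplication followed by comultiplication is applied to
the first two factors, the braiding `Hᘁ ⊗ ᘁH ⟶ ᘁH ⊗ Hᘁ` to the third and fourth, `S⁻²` to the
last one; two evaluations give `H ⊗ (H ⊗ ᘁH) ⊗ (Hᘁ ⊗ H) ⟶ H`. -/
def piRR [IsIso 𝒮[H]] : H ⟶ H :=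
  𝟙 H ⊗≫ H ◁ (η_ H (Hᘁ : C) ⊗ₘ η_ (ᘁH : C) H) ⊗≫
    ((μ[H] ≫ Δ[H]) ⊗ₘ (β_ (Hᘁ : C) (ᘁH : C)).hom ⊗ₘ (inv 𝒮[H] ≫ inv 𝒮[H])) ⊗≫
    H ◁ (ε_ (ᘁH : C) H ⊗ₘ ε_ H (Hᘁ : C)) ⊗≫ 𝟙 H

end Idempotents

end

end BraidedIntegral

open BraidedIntegral

/-! Everything rests on one Hopf identity. In Sweedler notation with braidings suppressed, b₁ ⊗ ab₂
= S(a₁)(a₂b)₁ ⊗ (a₂b)₂ (`tail_comul_mul_eq`). Let P(x) be the partial trace over h of h ⊗ x ↦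
S⁻²((hx)₁) ⊗ (hx)₂ (`projTail`). The identity, together with sliding actions and coactions around
the loop, shows that P is both a left integral in H and a left integral on H. If x comes from a left
integral in H, the loop opens and P(x) = x; likewise f ∘ P = f for a left integral f on H. So P is
an idempotent onto the left integrals of both kinds, and it equals `piLL H`.

The other three endomorphisms are the same P for H with opposite comultiplication, opposite
multiplication, or both. The first two are Hopf algebras for the reversed braiding with antipode
S⁻¹, the third is one for the original braiding with antipode S.

Projections sharing a class of integrals absorb one another, so splitting one of them yields all
four universal integrals. Conversely, for any integral object K with universal maps p : H ⟶ K and i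
: K ⟶ H, the composite i ≫ p has an inverse r and the projection is p ≫ r ≫ i
(`IsProjection.exists_inverse`); cyclicity of the trace then gives dim K.

For invertibility of K, the Hopf identity applied to integrals expresses the self-braiding of K as w
⊗ c (`tail_integrals_exchange`), which inverts K up to one scalar. That scalar is 1 because the
trace of S⁻¹ followed by P is 1 (`loop_invAntipode_projTail`), so that the unit is a retract of an
object containing K as a tensor factor. Automorphisms of an invertible object are scalars, which
supplies the constants. -/

namespace BraidedIntegral

/-! ### Rewriting an initial segment of a chain of compositions -/

section Rewriting

variable {C : Type u} [Category.{v} C] {A₀ A₁ A₂ A₃ A₄ B : C}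

lemma e2 {a : A₀ ⟶ A₁} {b : A₁ ⟶ A₂} {q : A₀ ⟶ A₂} (h : a ≫ b = q) (k : A₂ ⟶ B) :
    a ≫ b ≫ k = q ≫ k := by rw [← h, Category.assoc]

lemma e3 {a : A₀ ⟶ A₁} {b : A₁ ⟶ A₂} {c : A₂ ⟶ A₃} {q : A₀ ⟶ A₃} (h : a ≫ b ≫ c = q)
    (k : A₃ ⟶ B) : a ≫ b ≫ c ≫ k = q ≫ k := by simp only [← h, Category.assoc]

lemma e4 {a : A₀ ⟶ A₁} {b : A₁ ⟶ A₂} {c : A₂ ⟶ A₃} {d : A₃ ⟶ A₄} {q : A₀ ⟶ A₄}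
    (h : a ≫ b ≫ c ≫ d = q) (k : A₄ ⟶ B) : a ≫ b ≫ c ≫ d ≫ k = q ≫ k := by
  simp only [← h, Category.assoc]

end Rewriting

/-! ### Diagrammatic calculus on the first strands -/

section Tails

variable {C : Type u} [Category.{v} C] [MonoidalCategory C]

/-! ### Morphisms acting on the first factors of a right-nested tensor product -/

/-- The two digits count the strands consumed and produced. Associators and unitors stay inside
these definitions, so a string diagram becomes a chain of whiskerings without coherence maps. -/
def tail01 {X : C} (f : 𝟙_ C ⟶ X) (R : C) : R ⟶ X ⊗ R := (λ_ R).inv ≫ f ▷ R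

def tail10 {X : C} (f : X ⟶ 𝟙_ C) (R : C) : X ⊗ R ⟶ R := f ▷ R ≫ (λ_ R).hom

def tail02 {X Y : C} (f : 𝟙_ C ⟶ X ⊗ Y) (R : C) : R ⟶ X ⊗ Y ⊗ R :=
  (λ_ R).inv ≫ f ▷ R ≫ (α_ X Y R).hom

def tail20 {X Y : C} (f : X ⊗ Y ⟶ 𝟙_ C) (R : C) : X ⊗ Y ⊗ R ⟶ R :=
  (α_ X Y R).inv ≫ f ▷ R ≫ (λ_ R).hom

def tail21 {X Y Z : C} (f : X ⊗ Y ⟶ Z) (R : C) : X ⊗ Y ⊗ R ⟶ Z ⊗ R :=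
  (α_ X Y R).inv ≫ f ▷ R

def tail12 {X Y Z : C} (f : X ⟶ Y ⊗ Z) (R : C) : X ⊗ R ⟶ Y ⊗ Z ⊗ R :=
  f ▷ R ≫ (α_ Y Z R).hom

def tail22 {X Y Z W : C} (f : X ⊗ Y ⟶ Z ⊗ W) (R : C) : X ⊗ Y ⊗ R ⟶ Z ⊗ W ⊗ R :=
  (α_ X Y R).inv ≫ f ▷ R ≫ (α_ Z W R).hom

section Exchange

variable {X Y Z W R R' : C}

lemma ex01 (f : 𝟙_ C ⟶ X) (g : R ⟶ R') : tail01 f R ≫ X ◁ g = g ≫ tail01 f R' := by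
  simp [tail01, ← whisker_exchange]

lemma ex10 (f : X ⟶ 𝟙_ C) (g : R ⟶ R') : tail10 f R ≫ g = X ◁ g ≫ tail10 f R' := by
  simp [tail10, whisker_exchange_assoc]

lemma ex02 (f : 𝟙_ C ⟶ X ⊗ Y) (g : R ⟶ R') : tail02 f R ≫ X ◁ Y ◁ g = g ≫ tail02 f R' := by
  simp only [tail02, Category.assoc, ← associator_naturality_right, ← whisker_exchange_assoc]
  simp

lemma ex20 (f : X ⊗ Y ⟶ 𝟙_ C) (g : R ⟶ R') : tail20 f R ≫ g = X ◁ Y ◁ g ≫ tail20 f R' := by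
  simp only [tail20, Category.assoc, ← leftUnitor_naturality, ← whisker_exchange_assoc,
    associator_inv_naturality_right_assoc]

lemma ex21 (f : X ⊗ Y ⟶ Z) (g : R ⟶ R') :
    tail21 f R ≫ Z ◁ g = X ◁ Y ◁ g ≫ tail21 f R' := by
  simp [tail21, ← whisker_exchange]

lemma ex12 (f : X ⟶ Y ⊗ Z) (g : R ⟶ R') :
    tail12 f R ≫ Y ◁ Z ◁ g = X ◁ g ≫ tail12 f R' := by
  simp [tail12, whisker_exchange_assoc]

lemma ex22 (f : X ⊗ Y ⟶ Z ⊗ W) (g : R ⟶ R') :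
    tail22 f R ≫ Z ◁ W ◁ g = X ◁ Y ◁ g ≫ tail22 f R' := by
  simp only [tail22, Category.assoc, ← associator_naturality_right, ← whisker_exchange_assoc,
    associator_inv_naturality_right_assoc]

lemma ex11 (f : X ⟶ Y) (g : R ⟶ R') : f ▷ R ≫ Y ◁ g = X ◁ g ≫ f ▷ R' :=
  (whisker_exchange f g).symm

end Exchange

/-! Rewriting inside a chain of compositions, below left whiskerings. -/

section Rewriting

variable {A₀ A₁ A₂ A₃ A₄ B X Y Z : C}

lemma w2 {a : A₀ ⟶ A₁} {b : A₁ ⟶ A₂} {q : A₀ ⟶ A₂} (h : a ≫ b = q) (k : X ⊗ A₂ ⟶ B) :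
    X ◁ a ≫ X ◁ b ≫ k = X ◁ q ≫ k := by rw [← h, whiskerLeft_comp_assoc]

lemma w3 {a : A₀ ⟶ A₁} {b : A₁ ⟶ A₂} {c : A₂ ⟶ A₃} {q : A₀ ⟶ A₃} (h : a ≫ b ≫ c = q)
    (k : X ⊗ A₃ ⟶ B) : X ◁ a ≫ X ◁ b ≫ X ◁ c ≫ k = X ◁ q ≫ k := by
  simp only [← h, whiskerLeft_comp_assoc]

lemma ww2 {a : A₀ ⟶ A₁} {b : A₁ ⟶ A₂} {q : A₀ ⟶ A₂} (h : a ≫ b = q) (k : X ⊗ Y ⊗ A₂ ⟶ B) :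
    X ◁ Y ◁ a ≫ X ◁ Y ◁ b ≫ k = X ◁ Y ◁ q ≫ k := by simp only [← h, whiskerLeft_comp, Category.assoc]

end Rewriting

section Braiding

variable [BraidedCategory C]

/-- The braiding of the first two factors. -/
def br (X Y R : C) : X ⊗ Y ⊗ R ⟶ Y ⊗ X ⊗ R := tail22 (β_ X Y).hom R

/-- The inverse braiding of the first two factors. -/
def bi (X Y R : C) : Y ⊗ X ⊗ R ⟶ X ⊗ Y ⊗ R := tail22 (β_ X Y).inv R

lemma br_bi (X Y R : C) : br X Y R ≫ bi X Y R = 𝟙 _ := by simp [br, bi, tail22, ← comp_whiskerRight_assoc]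

lemma bi_br (X Y R : C) : bi X Y R ≫ br X Y R = 𝟙 _ := by simp [br, bi, tail22, ← comp_whiskerRight_assoc]

lemma br_ex {X Y R R' : C} (g : R ⟶ R') : br X Y R ≫ Y ◁ X ◁ g = X ◁ Y ◁ g ≫ br X Y R' := ex22 _ _

lemma bi_ex {X Y R R' : C} (g : R ⟶ R') : bi X Y R ≫ X ◁ Y ◁ g = Y ◁ X ◁ g ≫ bi X Y R' := ex22 _ _

variable {X Y Z W : C} (U R : C)

/-- In the names `brL` and `brR`, the morphism slid across the strand `U` starts on its left or on
its right; the digits count its inputs and outputs. Several strands are handled by the hexagon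
identities. -/
lemma brL11 (f : X ⟶ Y) : f ▷ (U ⊗ R) ≫ br Y U R = br X U R ≫ U ◁ f ▷ R := by
  simp only [br, tail22, Category.assoc, associator_inv_naturality_left_assoc,
    ← associator_naturality_middle, ← comp_whiskerRight_assoc,
    BraidedCategory.braiding_naturality_left]

lemma brR11 (f : X ⟶ Y) : U ◁ f ▷ R ≫ br U Y R = br U X R ≫ f ▷ (U ⊗ R) := by
  simp only [br, tail22, Category.assoc, associator_inv_naturality_middle_assoc,
    ← associator_naturality_left, ← comp_whiskerRight_assoc,
    BraidedCategory.braiding_naturality_right]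

lemma br_unit_left : br (𝟙_ C) U R = (λ_ (U ⊗ R)).hom ≫ U ◁ (λ_ R).inv := by
  simp [br, tail22]

lemma br_unit_right : br U (𝟙_ C) R = U ◁ (λ_ R).hom ≫ (λ_ (U ⊗ R)).inv := by
  simp [br, tail22]

lemma brL01 (f : 𝟙_ C ⟶ X) : tail01 f (U ⊗ R) ≫ br X U R = U ◁ tail01 f R := by
  simp only [tail01, Category.assoc, brL11, br_unit_left, whiskerLeft_comp, Iso.inv_hom_id_assoc]

lemma brR01 (f : 𝟙_ C ⟶ X) : U ◁ tail01 f R ≫ br U X R = tail01 f (U ⊗ R) := by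
  simp only [tail01, Category.assoc, brR11, br_unit_right, whiskerLeft_comp,
    whiskerLeft_inv_hom_assoc]

lemma brL10 (f : X ⟶ 𝟙_ C) : br X U R ≫ U ◁ tail10 f R = tail10 f (U ⊗ R) := by
  rw [tail10, whiskerLeft_comp, e2 (brL11 U R f).symm, br_unit_left]
  simp [tail10]

lemma brR10 (f : X ⟶ 𝟙_ C) : br U X R ≫ tail10 f (U ⊗ R) = U ◁ tail10 f R := by
  rw [tail10, e2 (brR11 U R f).symm, br_unit_right]
  simp [tail10]

lemma br_tensor_left : br (X ⊗ Y) U R =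
    (α_ X Y (U ⊗ R)).hom ≫ X ◁ br Y U R ≫ br X U (Y ⊗ R) ≫ U ◁ (α_ X Y R).inv := by
  simp only [br, tail22, BraidedCategory.braiding_tensor_left_hom]
  monoidal

lemma br_tensor_right : br U (X ⊗ Y) R =
    U ◁ (α_ X Y R).hom ≫ br U X (Y ⊗ R) ≫ X ◁ br U Y R ≫ (α_ X Y (U ⊗ R)).inv := by
  simp only [br, tail22, BraidedCategory.braiding_tensor_right_hom]
  monoidal

lemma brL21 (f : X ⊗ Y ⟶ Z) : tail21 f (U ⊗ R) ≫ br Z U R =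
    X ◁ br Y U R ≫ br X U (Y ⊗ R) ≫ U ◁ tail21 f R := by
  rw [tail21, Category.assoc, brL11, br_tensor_left]
  simp only [tail21, Category.assoc, Iso.inv_hom_id_assoc, whiskerLeft_comp]

lemma brR21 (f : X ⊗ Y ⟶ Z) : U ◁ tail21 f R ≫ br U Z R =
    br U X (Y ⊗ R) ≫ X ◁ br U Y R ≫ tail21 f (U ⊗ R) := by
  rw [tail21, whiskerLeft_comp, Category.assoc, brR11, br_tensor_right]
  simp only [tail21, Category.assoc, whiskerLeft_inv_hom_assoc]

lemma brL12 (f : X ⟶ Y ⊗ Z) : tail12 f (U ⊗ R) ≫ Y ◁ br Z U R ≫ br Y U (Z ⊗ R) =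
    br X U R ≫ U ◁ tail12 f R := by
  have := brL11 U R f
  rw [br_tensor_left] at this
  simp only [tail12, whiskerLeft_comp, ← reassoc_of% this, Category.assoc]
  simp

lemma brR12 (f : X ⟶ Y ⊗ Z) : U ◁ tail12 f R ≫ br U Y (Z ⊗ R) ≫ Y ◁ br U Z R =
    br U X R ≫ tail12 f (U ⊗ R) := by
  have := brR11 U R f
  rw [br_tensor_right] at this
  simp only [tail12, whiskerLeft_comp, ← reassoc_of% this, Category.assoc]
  simp

lemma brL22 (f : X ⊗ Y ⟶ Z ⊗ W) : tail22 f (U ⊗ R) ≫ Z ◁ br W U R ≫ br Z U (W ⊗ R) =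
    X ◁ br Y U R ≫ br X U (Y ⊗ R) ≫ U ◁ tail22 f R := by
  have h : ∀ R, tail22 f R = tail21 f R ≫ (α_ Z W R).hom := fun R => by simp [tail22, tail21]
  have := brL21 U R f
  rw [br_tensor_left] at this
  simp only [h, whiskerLeft_comp, ← reassoc_of% this, Category.assoc]
  simp

lemma brR22 (f : X ⊗ Y ⟶ Z ⊗ W) : U ◁ tail22 f R ≫ br U Z (W ⊗ R) ≫ Z ◁ br U W R =
    br U X (Y ⊗ R) ≫ X ◁ br U Y R ≫ tail22 f (U ⊗ R) := by
  have h : ∀ R, tail22 f R = tail21 f R ≫ (α_ Z W R).hom := fun R => by simp [tail22, tail21]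
  have := brR21 U R f
  rw [br_tensor_right] at this
  simp only [h, whiskerLeft_comp, ← reassoc_of% this, Category.assoc]
  simp

lemma brL02 (f : 𝟙_ C ⟶ X ⊗ Y) : tail02 f (U ⊗ R) ≫ X ◁ br Y U R ≫ br X U (Y ⊗ R) =
    U ◁ tail02 f R := by
  have h : ∀ R, tail02 f R = (λ_ R).inv ≫ tail12 f R := fun R => by simp [tail02, tail12]
  simp only [h, Category.assoc, brL12, br_unit_left, whiskerLeft_comp]
  simp

lemma brR02 (f : 𝟙_ C ⟶ X ⊗ Y) : U ◁ tail02 f R ≫ br U X (Y ⊗ R) ≫ X ◁ br U Y R =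
    tail02 f (U ⊗ R) := by
  have h : ∀ R, tail02 f R = (λ_ R).inv ≫ tail12 f R := fun R => by simp [tail02, tail12]
  simp only [h, Category.assoc, brR12, br_unit_right, whiskerLeft_comp]
  simp

lemma brL20 (f : X ⊗ Y ⟶ 𝟙_ C) : X ◁ br Y U R ≫ br X U (Y ⊗ R) ≫ U ◁ tail20 f R =
    tail20 f (U ⊗ R) := by
  have h : ∀ R, tail20 f R = tail21 f R ≫ (λ_ R).hom := fun R => by simp [tail20, tail21]
  have := brL21 U R f
  simp only [h, whiskerLeft_comp, ← reassoc_of% this, br_unit_left]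
  simp

end Braiding
section InverseBraiding

variable [BraidedCategory C] {X Y Z W : C} (U R : C)

/-- For the reversed braiding `br` is `bi`, so each rule for the inverse braiding is an instance of
the previous ones. -/
lemma biL11 (f : X ⟶ Y) : f ▷ (U ⊗ R) ≫ bi U Y R = bi U X R ≫ U ◁ f ▷ R :=
  @brL11 _ _ _ (reverseBraiding C) ..

lemma biR11 (f : X ⟶ Y) : U ◁ f ▷ R ≫ bi Y U R = bi X U R ≫ f ▷ (U ⊗ R) :=
  @brR11 _ _ _ (reverseBraiding C) ..

lemma biL01 (f : 𝟙_ C ⟶ X) : tail01 f (U ⊗ R) ≫ bi U X R = U ◁ tail01 f R :=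
  @brL01 _ _ _ (reverseBraiding C) ..

lemma biR01 (f : 𝟙_ C ⟶ X) : U ◁ tail01 f R ≫ bi X U R = tail01 f (U ⊗ R) :=
  @brR01 _ _ _ (reverseBraiding C) ..

lemma biL10 (f : X ⟶ 𝟙_ C) : bi U X R ≫ U ◁ tail10 f R = tail10 f (U ⊗ R) :=
  @brL10 _ _ _ (reverseBraiding C) ..

lemma biR10 (f : X ⟶ 𝟙_ C) : bi X U R ≫ tail10 f (U ⊗ R) = U ◁ tail10 f R :=
  @brR10 _ _ _ (reverseBraiding C) ..

lemma biL21 (f : X ⊗ Y ⟶ Z) : tail21 f (U ⊗ R) ≫ bi U Z R =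
    X ◁ bi U Y R ≫ bi U X (Y ⊗ R) ≫ U ◁ tail21 f R :=
  @brL21 _ _ _ (reverseBraiding C) ..

lemma biR21 (f : X ⊗ Y ⟶ Z) : U ◁ tail21 f R ≫ bi Z U R =
    bi X U (Y ⊗ R) ≫ X ◁ bi Y U R ≫ tail21 f (U ⊗ R) :=
  @brR21 _ _ _ (reverseBraiding C) ..

lemma biL12 (f : X ⟶ Y ⊗ Z) : tail12 f (U ⊗ R) ≫ Y ◁ bi U Z R ≫ bi U Y (Z ⊗ R) =
    bi U X R ≫ U ◁ tail12 f R :=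
  @brL12 _ _ _ (reverseBraiding C) ..

lemma biR12 (f : X ⟶ Y ⊗ Z) : U ◁ tail12 f R ≫ bi Y U (Z ⊗ R) ≫ Y ◁ bi Z U R =
    bi X U R ≫ tail12 f (U ⊗ R) :=
  @brR12 _ _ _ (reverseBraiding C) ..

lemma biL22 (f : X ⊗ Y ⟶ Z ⊗ W) :
    tail22 f (U ⊗ R) ≫ Z ◁ bi U W R ≫ bi U Z (W ⊗ R) =
      X ◁ bi U Y R ≫ bi U X (Y ⊗ R) ≫ U ◁ tail22 f R :=
  @brL22 _ _ _ (reverseBraiding C) ..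

lemma biR22 (f : X ⊗ Y ⟶ Z ⊗ W) :
    U ◁ tail22 f R ≫ bi Z U (W ⊗ R) ≫ Z ◁ bi W U R =
      bi X U (Y ⊗ R) ≫ X ◁ bi Y U R ≫ tail22 f (U ⊗ R) :=
  @brR22 _ _ _ (reverseBraiding C) ..

lemma biL02 (f : 𝟙_ C ⟶ X ⊗ Y) : tail02 f (U ⊗ R) ≫ X ◁ bi U Y R ≫ bi U X (Y ⊗ R) =
    U ◁ tail02 f R :=
  @brL02 _ _ _ (reverseBraiding C) ..

lemma biL20 (f : X ⊗ Y ⟶ 𝟙_ C) : X ◁ bi U Y R ≫ bi U X (Y ⊗ R) ≫ U ◁ tail20 f R =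
    tail20 f (U ⊗ R) :=
  @brL20 _ _ _ (reverseBraiding C) ..

end InverseBraiding
end Tails
end BraidedIntegral

/-! ### Duality, mates and partial traces -/

namespace BraidedIntegral
section Loops

variable {C : Type u} [Category.{v} C] [MonoidalCategory C] {D H : C} [ExactPairing D H]
  {X Y Z W R R' : C}

lemma zigzag_right (R : C) : H ◁ tail02 (η_ D H) R ≫ tail20 (ε_ D H) (H ⊗ R) = 𝟙 _ := by
  have h := congrArg (· ▷ R) (ExactPairing.coevaluation_evaluation D H)
  calc _ = 𝟙 _ ⊗≫ (H ◁ η_ D H ≫ (α_ H D H).inv ≫ ε_ D H ▷ H) ▷ R ⊗≫ 𝟙 _ := by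
        rw [tail02, tail20]; monoidal
    _ = _ := by rw [h]; monoidal

lemma zigzag_left (R : C) : tail02 (η_ D H) (D ⊗ R) ≫ D ◁ tail20 (ε_ D H) R = 𝟙 _ := by
  have h := congrArg (· ▷ R) (ExactPairing.evaluation_coevaluation D H)
  calc _ = 𝟙 _ ⊗≫ (η_ D H ▷ D ≫ (α_ D H D).hom ≫ D ◁ ε_ D H) ▷ R ⊗≫ 𝟙 _ := by
        rw [tail02, tail20]; monoidal
    _ = _ := by rw [h]; monoidal

section Mates

/-- The mate `Z ⊗ D ⟶ D` of `b : H ⊗ Z ⟶ H`. -/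
def mate21 (b : H ⊗ Z ⟶ H) : Z ⊗ D ⟶ D :=
  tail02 (η_ D H) (Z ⊗ D) ≫ D ◁ tail21 b D ≫ D ◁ ε_ D H ≫ (ρ_ D).hom

lemma tail21_mate21 (b : H ⊗ Z ⟶ H) (R : C) :
    tail21 (mate21 (D := D) b) R =
      tail02 (η_ D H) (Z ⊗ D ⊗ R) ≫ D ◁ tail21 b (D ⊗ R) ≫ D ◁ tail20 (ε_ D H) R := by
  simp only [mate21, tail21, tail02, tail20]
  monoidal

/-- With `mate21_eval`, this transfers an action on `H` through the coevaluation to `D` and back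
through the evaluation; the extra bend is straightened by `zigzag_right`. -/
lemma coeval_mate21 (b : H ⊗ Z ⟶ H) (R : C) :
    tail02 (η_ D H) (Z ⊗ R) ≫ D ◁ tail21 b R =
      Z ◁ tail02 (η_ D H) R ≫ tail21 (mate21 b) (H ⊗ R) := by
  -- The identity appended by `cancel_mono` provides the continuation that `w2` needs after the last
  -- factor.
  rw [tail21_mate21, e2 (ex02 (η_ D H) (Z ◁ tail02 (η_ D H) R)).symm, ← cancel_mono (𝟙 _)]
  simp only [Category.assoc]
  rw [w2 (ex21 b _).symm, ← whiskerLeft_comp_assoc]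
  simp only [Category.assoc, zigzag_right, Category.comp_id]

lemma mate21_eval (b : H ⊗ Z ⟶ H) (R : C) :
    H ◁ tail21 (mate21 (D := D) b) R ≫ tail20 (ε_ D H) R =
      tail21 b (D ⊗ R) ≫ tail20 (ε_ D H) R := by
  simp only [tail21_mate21, whiskerLeft_comp, Category.assoc]
  rw [← ex20, e2 (ex20 _ _).symm, Category.assoc, e2 (zigzag_right _), Category.id_comp]

/-- The mate `D ⟶ D ⊗ Z` of `d : H ⟶ Z ⊗ H`. -/
def mate12 (d : H ⟶ Z ⊗ H) : D ⟶ D ⊗ Z :=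
  tail02 (η_ D H) D ≫ D ◁ tail12 d D ≫ D ◁ Z ◁ ε_ D H ≫ D ◁ (ρ_ Z).hom

lemma tail12_mate12 (d : H ⟶ Z ⊗ H) (R : C) :
    tail12 (mate12 (D := D) d) R =
      tail02 (η_ D H) (D ⊗ R) ≫ D ◁ tail12 d (D ⊗ R) ≫ D ◁ Z ◁ tail20 (ε_ D H) R := by
  simp only [mate12, tail12, tail02, tail20]
  monoidal

lemma coeval_mate12 (d : H ⟶ Z ⊗ H) (R : C) :
    tail02 (η_ D H) R ≫ D ◁ tail12 d R =
      tail02 (η_ D H) R ≫ tail12 (mate12 d) (H ⊗ R) := by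
  rw [tail12_mate12, e2 (ex02 (η_ D H) (tail02 (η_ D H) R)).symm, ← cancel_mono (𝟙 _)]
  simp only [Category.assoc]
  rw [w2 (ex12 d _).symm, ← whiskerLeft_comp_assoc]
  simp only [Category.assoc, ← whiskerLeft_comp, zigzag_right, whiskerLeft_id, Category.comp_id]

lemma mate12_eval (d : H ⟶ Z ⊗ H) (R : C) :
    H ◁ tail12 (mate12 (D := D) d) R ≫ tail20 (ε_ D H) (Z ⊗ R) =
      tail12 d (D ⊗ R) ≫ Z ◁ tail20 (ε_ D H) R := by
  simp only [tail12_mate12, whiskerLeft_comp, Category.assoc]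
  rw [← ex20, e2 (ex20 _ _).symm, Category.assoc, e2 (zigzag_right _), Category.id_comp]

/-- The mate `D ⟶ D ⊗ D` of `m : H ⊗ H ⟶ H`. -/
def mate22 (m : H ⊗ H ⟶ H) : D ⟶ D ⊗ D :=
  tail02 (η_ D H) D ≫ D ◁ tail02 (η_ D H) (H ⊗ D) ≫ D ◁ D ◁ tail21 m D ≫
    D ◁ D ◁ ε_ D H ≫ D ◁ (ρ_ D).hom

lemma tail12_mate22 (m : H ⊗ H ⟶ H) (R : C) :
    tail12 (mate22 (D := D) m) R =
      tail02 (η_ D H) (D ⊗ R) ≫ D ◁ tail02 (η_ D H) (H ⊗ D ⊗ R) ≫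
        D ◁ D ◁ tail21 m (D ⊗ R) ≫ D ◁ D ◁ tail20 (ε_ D H) R := by
  simp only [mate22, tail21, tail12, tail02, tail20]
  monoidal

lemma coeval_mate22 (m : H ⊗ H ⟶ H) (R : C) :
    tail02 (η_ D H) R ≫ D ◁ tail02 (η_ D H) (H ⊗ R) ≫ D ◁ D ◁ tail21 m R =
      tail02 (η_ D H) R ≫ tail12 (mate22 m) (H ⊗ R) := by
  rw [tail12_mate22, e2 (ex02 (η_ D H) (tail02 (η_ D H) R)).symm, ← cancel_mono (𝟙 _)]
  simp only [Category.assoc]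
  rw [w2 (ex02 (η_ D H) (H ◁ tail02 (η_ D H) R)).symm]
  simp only [whiskerLeft_comp, Category.assoc]
  rw [ww2 (ex21 m _).symm]
  simp only [whiskerLeft_comp, Category.assoc]
  rw [ww2 (zigzag_right _)]
  simp

lemma mate22_eval (m : H ⊗ H ⟶ H) (R : C) :
    H ◁ H ◁ tail12 (mate22 (D := D) m) R ≫ H ◁ tail20 (ε_ D H) (D ⊗ R) ≫ tail20 (ε_ D H) R =
      tail21 m (D ⊗ R) ≫ tail20 (ε_ D H) R := by
  have h : H ◁ tail12 (mate22 (D := D) m) R ≫ tail20 (ε_ D H) (D ⊗ R) =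
      tail02 (η_ D H) (H ⊗ D ⊗ R) ≫ D ◁ tail21 m (D ⊗ R) ≫ D ◁ tail20 (ε_ D H) R := by
    simp only [tail12_mate22, ← whiskerLeft_comp]
    rw [whiskerLeft_comp, Category.assoc, ← ex20, e2 (zigzag_right _), Category.id_comp]
  rw [w2 h]
  simp only [whiskerLeft_comp, Category.assoc]
  rw [← ex20, e2 (ex20 _ _).symm, Category.assoc, e2 (zigzag_right _), Category.id_comp]

end Mates

variable [BraidedCategory C]

variable (D H) in
/-- The evaluation with its arguments interchanged by the inverse braiding. -/
def crossedEval : D ⊗ H ⟶ 𝟙_ C := (β_ H D).inv ≫ ε_ D H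

lemma tail20_crossedEval (R : C) :
    tail20 (crossedEval D H) R = bi H D R ≫ tail20 (ε_ D H) R := by
  simp [crossedEval, tail20, bi, tail22]

variable (D) in
/-- The partial trace of `F` over its first argument. -/
def loop (F : H ⊗ R ⟶ H ⊗ R') : R ⟶ R' :=
  tail02 (η_ D H) R ≫ D ◁ F ≫ tail20 (crossedEval D H) R'

lemma comp_loop (g : X ⟶ R) (F : H ⊗ R ⟶ H ⊗ R') : g ≫ loop D F = loop D (H ◁ g ≫ F) := by
  rw [loop, e2 (ex02 (η_ D H) g).symm, loop]
  simp only [whiskerLeft_comp, Category.assoc]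

lemma loop_comp (F : H ⊗ R ⟶ H ⊗ R') (g : R' ⟶ X) : loop D F ≫ g = loop D (F ≫ H ◁ g) := by
  simp only [loop, Category.assoc, ex20, whiskerLeft_comp]

/-- A closed loop can be pulled across the strand `Z` on either side; `whiskerLeft_loop'` is the
other side. The integral property in `H` uses one choice, that on `H` the other. -/
lemma whiskerLeft_loop (Z : C) (F : H ⊗ R ⟶ H ⊗ R') :
    Z ◁ loop D F = loop D (bi Z H R ≫ Z ◁ F ≫ br Z H R') := by
  simp only [loop, whiskerLeft_comp, Category.assoc, ← biL02]
  rw [e2 (bi_ex _), ← biL20, w2 (br_bi ..)]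
  simp

lemma whiskerLeft_loop' (Z : C) (F : H ⊗ R ⟶ H ⊗ R') :
    Z ◁ loop D F = loop D (br H Z R ≫ Z ◁ F ≫ bi H Z R') := by
  simp only [loop, whiskerLeft_comp, Category.assoc, ← brL02]
  rw [e2 (br_ex _), ← brL20, w2 (bi_br ..)]
  simp

/-- An action of `Z` on the loop may be carried around the loop. -/
lemma loop_slide_mul (b : H ⊗ Z ⟶ H) (F : H ⊗ R ⟶ H ⊗ R') :
    loop D (tail21 b R ≫ F) = loop D (bi Z H R ≫ Z ◁ F ≫ bi H Z R' ≫ tail21 b R') := by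
  -- At the evaluation the mate on `D` becomes the action on `H` again, at the cost of the crossing
  -- contained in `crossedEval`.
  have key : br Z D (H ⊗ R') ≫ D ◁ bi H Z R' ≫ D ◁ tail21 b R' ≫ tail20 (crossedEval D H) R' =
      tail21 (mate21 b) (H ⊗ R') ≫ tail20 (crossedEval D H) R' := by
    have h := biL22 H R' (β_ Z D).hom
    change br Z D _ ≫ _ = _ ≫ _ ≫ _ ◁ br Z D _ at h
    simp only [tail20_crossedEval]
    rw [e2 (biR21 ..), Category.assoc, Category.assoc, e2 (biL21 ..), Category.assoc,
      Category.assoc, mate21_eval, e3 h]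
    simp only [Category.assoc]
    rw [w2 (br_bi ..)]
    simp
  simp only [loop, whiskerLeft_comp, Category.assoc]
  rw [e2 (coeval_mate21 ..), Category.assoc, e2 (ex21 _ _), Category.assoc, ← key,
    ← biL02]
  simp only [Category.assoc]
  rw [e2 (bi_ex _)]
  simp only [Category.assoc]
  rw [e2 (bi_br ..)]
  simp

/-- A coaction of `Z` on the loop may be carried around the loop. -/
lemma loop_slide_comul (d : H ⟶ Z ⊗ H) (F : H ⊗ R ⟶ H ⊗ R') :
    loop D (F ≫ tail12 d R' ≫ br Z H R') = loop D (tail12 d R ≫ Z ◁ F ≫ bi H Z R') := by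
  have key : tail12 (mate12 d) (H ⊗ R') ≫ D ◁ bi H Z R' ≫ tail20 (crossedEval D H) (Z ⊗ R') =
      D ◁ tail12 d R' ≫ D ◁ br Z H R' ≫ tail20 (crossedEval D H) (Z ⊗ R') := by
    conv_rhs => rw [← biL20 Z R' (crossedEval D H), w2 (br_bi ..)]
    simp only [tail20_crossedEval, whiskerLeft_comp, whiskerLeft_id, Category.id_comp]
    rw [e3 (biL12 ..), Category.assoc, mate12_eval, e3 (biR12 ..), Category.assoc]
  simp only [loop, whiskerLeft_comp, Category.assoc]
  rw [← key, e2 (ex12 _ _).symm, e2 (coeval_mate12 ..)]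
  simp only [Category.assoc]

/-- A loop whose input is discarded opens up. -/
lemma loop_counit (e : H ⟶ 𝟙_ C) (G : R ⟶ H ⊗ R') :
    loop D (tail10 e R ≫ G) = G ≫ tail10 e R' := by
  rw [loop, ex10, whiskerLeft_comp, Category.assoc, e2 (ex02 (η_ D H) G), Category.assoc,
    ← biL10, tail20_crossedEval, whiskerLeft_comp, Category.assoc, e2 (bi_ex _).symm,
    Category.assoc, e3 (biL02 ..), ← ex20, e2 (zigzag_right _), Category.id_comp]

/-- A loop whose output does not depend on its input opens up. -/
lemma loop_unit (e : 𝟙_ C ⟶ H) (G : H ⊗ R ⟶ R') :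
    loop D (G ≫ tail01 e R') = tail01 e R ≫ G := by
  rw [loop, ← ex01, tail20_crossedEval, whiskerLeft_comp, Category.assoc,
    e2 (bi_ex _).symm, Category.assoc, e2 (biR01 ..), ← ex20, e2 (ex01 _ _).symm, Category.assoc,
    e2 (zigzag_right _), Category.id_comp]

/-- All crossings are moved before the plain nested evaluations, the shape to which `mate22_eval`
applies. The relation `h'` carries a crossing of two `H` strands past two `D` strands. -/
lemma nested_crossedEval (R : C) :
    D ◁ tail20 (crossedEval D H) (H ⊗ R) ≫ tail20 (crossedEval D H) R =
      D ◁ D ◁ bi H H R ≫ D ◁ D ◁ bi H H R ≫ D ◁ bi H D (H ⊗ R) ≫ bi H D (D ⊗ H ⊗ R) ≫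
        H ◁ D ◁ bi H D R ≫ H ◁ bi H D (D ⊗ R) ≫ H ◁ tail20 (ε_ D H) (D ⊗ R) ≫
        tail20 (ε_ D H) R := by
  have h : ∀ R : C, D ◁ bi H H R ≫ bi H D (H ⊗ R) ≫ H ◁ bi H D R =
      bi H D (H ⊗ R) ≫ H ◁ bi H D R ≫ bi H H (D ⊗ R) := fun R => biR22 D R (β_ H H).inv
  have h' : D ◁ D ◁ bi H H R ≫ D ◁ bi H D (H ⊗ R) ≫ bi H D (D ⊗ H ⊗ R) ≫
      H ◁ D ◁ bi H D R ≫ H ◁ bi H D (D ⊗ R) =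
      D ◁ bi H D (H ⊗ R) ≫ bi H D (D ⊗ H ⊗ R) ≫
      H ◁ D ◁ bi H D R ≫ H ◁ bi H D (D ⊗ R) ≫ bi H H (D ⊗ D ⊗ R) := by
    rw [e2 (bi_ex _), Category.assoc, e2 (bi_ex _), Category.assoc, w3 (h R), ← h (D ⊗ R)]
    simp only [whiskerLeft_comp, Category.assoc]
  rw [← biL20 H R (crossedEval D H), tail20_crossedEval]
  simp only [whiskerLeft_comp, Category.assoc]
  rw [e2 (bi_ex _).symm, Category.assoc]
  rw [e2 (bi_ex _).symm, Category.assoc, ← ex20 (ε_ D H) (tail20 (ε_ D H) R),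
    ← biL20 H (D ⊗ R) (ε_ D H)]
  simp only [Category.assoc]
  rw [← reassoc_of% h']

end Loops
end BraidedIntegral

/-! ### Hopf algebra identities on the first strands -/

namespace BraidedIntegral
section Hopf

variable {C : Type u} [Category.{v} C] [MonoidalCategory C]

section TailComp

variable {X Y Z W V : C}

lemma tail21_comp (f : X ⊗ Y ⟶ Z) (g : Z ⟶ W) (R : C) :
    tail21 f R ≫ g ▷ R = tail21 (f ≫ g) R := by simp [tail21]

lemma comp_tail12 (g : W ⟶ X) (f : X ⟶ Y ⊗ Z) (R : C) :
    g ▷ R ≫ tail12 f R = tail12 (g ≫ f) R := by simp [tail12]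

lemma tail12_comp_right (f : X ⟶ Y ⊗ Z) (g : Z ⟶ W) (R : C) :
    tail12 f R ≫ Y ◁ g ▷ R = tail12 (f ≫ Y ◁ g) R := by simp [tail12]

lemma tail12_comp_left (f : X ⟶ Y ⊗ Z) (g : Y ⟶ W) (R : C) :
    tail12 f R ≫ g ▷ (Z ⊗ R) = tail12 (f ≫ g ▷ Z) R := by simp [tail12]

lemma tail21_comp_right (f : X ⊗ Y ⟶ Z) (g : W ⟶ Y) (R : C) :
    X ◁ g ▷ R ≫ tail21 f R = tail21 (X ◁ g ≫ f) R := by simp [tail21]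

lemma tail21_comp_left (f : X ⊗ Y ⟶ Z) (g : W ⟶ X) (R : C) :
    g ▷ (Y ⊗ R) ≫ tail21 f R = tail21 (g ▷ Y ≫ f) R := by simp [tail21]

lemma tail12_tail21 (f : X ⟶ Y ⊗ Z) (g : Y ⊗ Z ⟶ W) (R : C) :
    tail12 f R ≫ tail21 g R = (f ≫ g) ▷ R := by simp [tail12, tail21]

lemma tail21_tail12 (f : X ⊗ Y ⟶ Z) (g : Z ⟶ V ⊗ W) (R : C) :
    tail21 f R ≫ tail12 g R = tail22 (f ≫ g) R := by simp [tail12, tail21, tail22]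

lemma tail10_tail01 (f : X ⟶ 𝟙_ C) (g : 𝟙_ C ⟶ W) (R : C) :
    tail10 f R ≫ tail01 g R = (f ≫ g) ▷ R := by simp [tail10, tail01]

lemma tail01_tail10 (f : 𝟙_ C ⟶ X) (g : X ⟶ 𝟙_ C) (R : C) :
    tail01 f R ≫ tail10 g R = (λ_ R).inv ≫ (f ≫ g) ▷ R ≫ (λ_ R).hom := by simp [tail10, tail01]

lemma comp_tail10 (f : X ⟶ Y) (g : Y ⟶ 𝟙_ C) (R : C) :
    f ▷ R ≫ tail10 g R = tail10 (f ≫ g) R := by simp [tail10]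

lemma tail01_comp (f : 𝟙_ C ⟶ X) (g : X ⟶ Y) (R : C) :
    tail01 f R ≫ g ▷ R = tail01 (f ≫ g) R := by simp [tail01]

variable [BraidedCategory C]

lemma tail12_bi (f : X ⟶ Y ⊗ Z) (R : C) :
    tail12 f R ≫ bi Z Y R = tail12 (f ≫ (β_ Z Y).inv) R := by simp [tail12, bi, tail22]

lemma br_tail21 (f : Z ⊗ Y ⟶ X) (R : C) :
    br Y Z R ≫ tail21 f R = tail21 ((β_ Y Z).hom ≫ f) R := by simp [tail21, br, tail22]

lemma bi_tail21 (f : Z ⊗ Y ⟶ X) (R : C) :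
    bi Z Y R ≫ tail21 f R = tail21 ((β_ Z Y).inv ≫ f) R := by simp [tail21, bi, tail22]

end TailComp

variable (H : C)

section Mon
variable [MonObj H] (R : C)

lemma tail_mul_assoc : H ◁ tail21 μ[H] R ≫ tail21 μ[H] R =
    tail21 μ[H] (H ⊗ R) ≫ tail21 μ[H] R := by
  have h := congrArg (· ▷ R) (MonObj.mul_assoc H)
  calc _ = 𝟙 _ ⊗≫ ((α_ H H H).hom ≫ H ◁ μ[H] ≫ μ[H]) ▷ R := by rw [tail21]; monoidal
    _ = 𝟙 _ ⊗≫ (μ[H] ▷ H ≫ μ[H]) ▷ R := by rw [MonObj.mul_assoc]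
    _ = _ := by rw [tail21, tail21]; monoidal

lemma tail_one_mul : tail01 η[H] (H ⊗ R) ≫ tail21 μ[H] R = 𝟙 _ := by
  calc _ = 𝟙 _ ⊗≫ (η[H] ▷ H ≫ μ[H]) ▷ R := by rw [tail21, tail01]; monoidal
    _ = _ := by rw [MonObj.one_mul]; monoidal

lemma tail_mul_one : H ◁ tail01 η[H] R ≫ tail21 μ[H] R = 𝟙 _ := by
  calc _ = 𝟙 _ ⊗≫ (H ◁ η[H] ≫ μ[H]) ▷ R := by rw [tail21, tail01]; monoidal
    _ = _ := by rw [MonObj.mul_one]; monoidal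

end Mon

section Comon
variable [ComonObj H] (R : C)

lemma tail_comul_assoc : tail12 Δ[H] R ≫ H ◁ tail12 Δ[H] R =
    tail12 Δ[H] R ≫ tail12 Δ[H] (H ⊗ R) := by
  calc _ = (Δ[H] ≫ H ◁ Δ[H]) ▷ R ⊗≫ 𝟙 _ := by rw [tail12]; monoidal
    _ = _ := by rw [ComonObj.comul_assoc, tail12, tail12]; monoidal

lemma tail_counit_comul : tail12 Δ[H] R ≫ tail10 ε[H] (H ⊗ R) = 𝟙 _ := by
  calc _ = (Δ[H] ≫ ε[H] ▷ H) ▷ R ⊗≫ 𝟙 _ := by rw [tail12, tail10]; monoidal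
    _ = _ := by rw [ComonObj.counit_comul]; monoidal

lemma tail_comul_counit : tail12 Δ[H] R ≫ H ◁ tail10 ε[H] R = 𝟙 _ := by
  calc _ = (Δ[H] ≫ H ◁ ε[H]) ▷ R ⊗≫ 𝟙 _ := by rw [tail12, tail10]; monoidal
    _ = _ := by rw [ComonObj.comul_counit]; monoidal

end Comon

variable [BraidedCategory C]

variable {H} in
-- The maps `m` and `d` are arbitrary so that the formula also serves the opposite structures and
-- the reversed braiding.
lemma tail22_tensorμ (m : H ⊗ H ⟶ H) (d : H ⟶ H ⊗ H) (R : C) :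
    tail22 ((d ⊗ₘ d) ≫ tensorμ H H H H ≫ (m ⊗ₘ m)) R =
      H ◁ tail12 d R ≫ tail12 d (H ⊗ H ⊗ R) ≫ H ◁ br H H (H ⊗ R) ≫
        tail21 m (H ⊗ H ⊗ R) ≫ H ◁ tail21 m R := by
  simp only [tail12, tail21, tail22, br, tensorμ, tensorHom_def' d, tensorHom_def m m]
  monoidal

section Bimon
variable [BimonObj H] (R : C)

lemma tail_mul_comul : tail21 μ[H] R ≫ tail12 Δ[H] R =
    H ◁ tail12 Δ[H] R ≫ tail12 Δ[H] (H ⊗ H ⊗ R) ≫ H ◁ br H H (H ⊗ R) ≫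
      tail21 μ[H] (H ⊗ H ⊗ R) ≫ H ◁ tail21 μ[H] R := by
  rw [tail21_tail12, BimonObj.mul_comul, tail22_tensorμ]

lemma tail_one_counit : tail01 η[H] R ≫ tail10 ε[H] R = 𝟙 _ := by
  rw [tail01_tail10, BimonObj.one_counit]; simp

end Bimon

section Antipode
variable [HopfObj H] (R : C)

lemma tail_antipode_left : tail12 Δ[H] R ≫ 𝒮[H] ▷ (H ⊗ R) ≫ tail21 μ[H] R =
    tail10 ε[H] R ≫ tail01 η[H] R := by
  rw [tail21_comp_left, tail12_tail21, HopfObj.antipode_left, tail10_tail01]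

variable [IsIso 𝒮[H]]

lemma mul_invAntipode : μ[H] ≫ inv 𝒮[H] =
    (β_ H H).inv ≫ (inv 𝒮[H] ⊗ₘ inv 𝒮[H]) ≫ μ[H] := by
  rw [← cancel_epi (β_ H H).hom, ← cancel_epi (𝒮[H] ⊗ₘ 𝒮[H]), ← cancel_mono 𝒮[H]]
  simp [HopfObj.mul_antipode]

lemma invAntipode_comul : inv 𝒮[H] ≫ Δ[H] =
    Δ[H] ≫ (inv 𝒮[H] ⊗ₘ inv 𝒮[H]) ≫ (β_ H H).inv := by
  rw [← cancel_mono (β_ H H).hom, ← cancel_mono (𝒮[H] ⊗ₘ 𝒮[H]), ← cancel_epi 𝒮[H]]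
  simp [HopfObj.antipode_comul]

lemma one_invAntipode : η[H] ≫ inv 𝒮[H] = η[H] := by simp [IsIso.comp_inv_eq]

lemma invAntipode_counit : inv 𝒮[H] ≫ ε[H] = ε[H] := by simp [IsIso.inv_comp_eq]

/-- The inverse antipode is an antipode for the opposite multiplication. -/
lemma invAntipode_left :
    Δ[H] ≫ inv 𝒮[H] ▷ H ≫ (β_ H H).inv ≫ μ[H] = ε[H] ≫ η[H] := by
  rw [← cancel_mono 𝒮[H]]
  simp only [Category.assoc, HopfObj.mul_antipode, HopfObj.one_antipode]
  rw [← HopfObj.antipode_right]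
  have h : inv 𝒮[H] ▷ H ≫ (𝒮[H] ⊗ₘ 𝒮[H]) = H ◁ 𝒮[H] := by
    rw [MonoidalCategory.tensorHom_def, ← comp_whiskerRight_assoc, IsIso.inv_hom_id]; simp
  simp [reassoc_of% h]

lemma invAntipode_right :
    Δ[H] ≫ H ◁ inv 𝒮[H] ≫ (β_ H H).inv ≫ μ[H] = ε[H] ≫ η[H] := by
  rw [← cancel_mono 𝒮[H]]
  simp only [Category.assoc, HopfObj.mul_antipode, HopfObj.one_antipode]
  rw [← HopfObj.antipode_left]
  have h : H ◁ inv 𝒮[H] ≫ (𝒮[H] ⊗ₘ 𝒮[H]) = 𝒮[H] ▷ H := by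
    rw [MonoidalCategory.tensorHom_def', ← whiskerLeft_comp_assoc, IsIso.inv_hom_id]; simp
  simp [reassoc_of% h]

lemma tail_mul_invAntipode : tail21 μ[H] R ≫ inv 𝒮[H] ▷ R =
    bi H H R ≫ inv 𝒮[H] ▷ (H ⊗ R) ≫ H ◁ inv 𝒮[H] ▷ R ≫ tail21 μ[H] R := by
  rw [tail21_comp, mul_invAntipode, tail21_comp_right, tail21_comp_left, bi_tail21,
    MonoidalCategory.tensorHom_def, Category.assoc]

lemma tail_invAntipode_comul : inv 𝒮[H] ▷ R ≫ tail12 Δ[H] R =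
    tail12 Δ[H] R ≫ bi H H R ≫ inv 𝒮[H] ▷ (H ⊗ R) ≫ H ◁ inv 𝒮[H] ▷ R := by
  rw [comp_tail12, invAntipode_comul, e2 (tail12_bi ..), e2 (tail12_comp_left ..),
    tail12_comp_right, Category.assoc, Category.assoc, BraidedCategory.braiding_inv_naturality,
    MonoidalCategory.tensorHom_def]

/-- The inverse of the square of the antipode. -/
noncomputable def invSq : H ⟶ H := inv 𝒮[H] ≫ inv 𝒮[H]

lemma invSq_antipode : invSq H ≫ 𝒮[H] = inv 𝒮[H] := by simp [invSq]

lemma antipode_invSq : 𝒮[H] ≫ invSq H = inv 𝒮[H] := by simp [invSq]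

lemma one_invSq : η[H] ≫ invSq H = η[H] := by
  rw [invSq, ← Category.assoc, one_invAntipode, one_invAntipode]

lemma invSq_counit : invSq H ≫ ε[H] = ε[H] := by
  rw [invSq, Category.assoc, invAntipode_counit, invAntipode_counit]

/-- Each inverse antipode reverses products at the cost of an inverse crossing. The two crossings
form a full twist, which need not cancel. -/
lemma tail_mul_invSq : tail21 μ[H] R ≫ invSq H ▷ R =
    bi H H R ≫ bi H H R ≫ invSq H ▷ (H ⊗ R) ≫
      H ◁ invSq H ▷ R ≫ tail21 μ[H] R := by
  simp only [invSq, comp_whiskerRight, whiskerLeft_comp, Category.assoc]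
  rw [e2 (tail_mul_invAntipode ..)]
  simp only [Category.assoc]
  rw [tail_mul_invAntipode, e2 (biR11 ..), Category.assoc, e2 (biL11 ..), Category.assoc,
    e2 (ex11 _ (inv 𝒮[H] ▷ R)).symm, Category.assoc,
    e2 (ex11 _ (inv 𝒮[H] ▷ R)).symm, Category.assoc]

lemma tail_invSq_comul : invSq H ▷ R ≫ tail12 Δ[H] R =
    tail12 Δ[H] R ≫ bi H H R ≫ bi H H R ≫ invSq H ▷ (H ⊗ R) ≫
      H ◁ invSq H ▷ R := by
  simp only [invSq, comp_whiskerRight, whiskerLeft_comp, Category.assoc]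
  rw [tail_invAntipode_comul, e2 (tail_invAntipode_comul ..)]
  simp only [Category.assoc]
  rw [e2 (biR11 ..), Category.assoc, e2 (biL11 ..), Category.assoc, e2 (ex11 _ (inv 𝒮[H] ▷ R)).symm,
    Category.assoc, e2 (ex11 _ (inv 𝒮[H] ▷ R)).symm, Category.assoc]

lemma tail_invAntipode_left :
    tail12 Δ[H] R ≫ inv 𝒮[H] ▷ (H ⊗ R) ≫ bi H H R ≫ tail21 μ[H] R =
      tail10 ε[H] R ≫ tail01 η[H] R := by
  rw [bi_tail21, tail21_comp_left, tail12_tail21, invAntipode_left, tail10_tail01]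

lemma tail_invAntipode_right :
    tail12 Δ[H] R ≫ bi H H R ≫ inv 𝒮[H] ▷ (H ⊗ R) ≫ tail21 μ[H] R =
      tail10 ε[H] R ≫ tail01 η[H] R := by
  rw [e2 (biR11 ..).symm, Category.assoc, bi_tail21, tail21_comp_right, tail12_tail21,
    invAntipode_right, tail10_tail01]

end Antipode
end Hopf
end BraidedIntegral

/-! ### The projection onto left integrals and its trace -/

namespace BraidedIntegral
section Projection

variable {C : Type u} [Category.{v} C] [MonoidalCategory C] [BraidedCategory C]
variable (D H : C) [ExactPairing D H] [HopfObj H] (R : C)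

/-- On the right, expanding the coproduct of a₂b gives S(a₁)a₂b₁ ⊗ a₃b₂, and the antipode axiom
cancels S(a₁)a₂. -/
lemma tail_comul_mul_eq :
    H ◁ tail12 Δ[H] R ≫ br H H (H ⊗ R) ≫ H ◁ tail21 μ[H] R =
      tail12 Δ[H] (H ⊗ R) ≫ 𝒮[H] ▷ (H ⊗ H ⊗ R) ≫ H ◁ tail21 μ[H] R ≫
        H ◁ tail12 Δ[H] R ≫ tail21 μ[H] (H ⊗ R) := by
  rw [w2 (tail_mul_comul ..)]
  simp only [whiskerLeft_comp, Category.assoc]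
  rw [(ex21 μ[H] (tail21 μ[H] R)).symm, e2 (tail_mul_assoc ..), Category.assoc,
    e2 (ex11 _ _), Category.assoc, e2 (ex12 Δ[H] (tail12 Δ[H] R)), Category.assoc,
    e2 (ex11 𝒮[H] (tail12 Δ[H] (H ⊗ H ⊗ R))), Category.assoc, e2 (tail_comul_assoc ..),
    Category.assoc, e2 (ex11 𝒮[H] (H ◁ br H H (H ⊗ R))), Category.assoc,
    e2 (ex12 Δ[H] (br H H (H ⊗ R))), Category.assoc, e3 (tail_antipode_left ..), Category.assoc,
    e2 (tail_one_mul ..), Category.id_comp, e2 (ex10 _ _).symm, Category.assoc,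
    e2 (tail_counit_comul ..), Category.id_comp]

variable [IsIso 𝒮[H]]

/-- The projection onto the left integrals, acting on the first tensor factor. -/
noncomputable def projTail : H ⊗ R ⟶ H ⊗ R :=
  loop D (tail21 μ[H] R ≫ tail12 Δ[H] R ≫ invSq H ▷ (H ⊗ R))

/-- By `tail_comul_mul_eq`, multiplying the output (hx)₂ by a puts a₂ in front of h and S(a₁) on the
looped output, where S⁻² makes it S⁻¹(a₁). Carried around the loop, this factor meets a₂, and
a₂S⁻¹(a₁) = ε(a). -/
lemma projTail_integral_in :
    H ◁ projTail D H R ≫ tail21 μ[H] R = tail10 ε[H] (H ⊗ R) ≫ projTail D H R := by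
  have key : bi H H (H ⊗ R) ≫ H ◁ tail21 μ[H] R ≫ H ◁ tail12 Δ[H] R ≫ H ◁ invSq H ▷ (H ⊗ R) ≫
      br H H (H ⊗ R) ≫ H ◁ tail21 μ[H] R =
      H ◁ tail12 Δ[H] (H ⊗ R) ≫ bi H H (H ⊗ H ⊗ R) ≫
        H ◁ (bi H H (H ⊗ R) ≫ H ◁ tail21 μ[H] R ≫ tail21 μ[H] R ≫ tail12 Δ[H] R ≫
          invSq H ▷ (H ⊗ R)) ≫ bi H H (H ⊗ R) ≫
        tail21 ((β_ H H).inv ≫ inv 𝒮[H] ▷ H ≫ μ[H]) (H ⊗ R) := by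
    rw [e2 (brR11 ..), Category.assoc, ex11, e3 (tail_comul_mul_eq ..)]
    simp only [Category.assoc, whiskerLeft_comp, ← bi_tail21, ← tail21_comp_left]
    rw [tail_mul_invSq, e3 (biR12 ..)]
    simp only [Category.assoc]
    rw [e2 (ex12 _ (tail21 μ[H] R)), Category.assoc]
    rw [e2 (ex11 𝒮[H] (tail21 μ[H] R)), Category.assoc, e2 (ex11 𝒮[H] (tail12 Δ[H] R)),
      Category.assoc, e2 (biL11 (f := 𝒮[H]) ..), Category.assoc, e2 (biR11 (f := 𝒮[H]) ..),
      Category.assoc, ← comp_whiskerRight_assoc, antipode_invSq, e2 (biR11 (f := invSq H) ..),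
      Category.assoc, e2 (biL11 (f := invSq H) ..), Category.assoc,
      e2 (ex11 (inv 𝒮[H]) (invSq H ▷ (H ⊗ R))).symm, Category.assoc]
  have key2 : H ◁ tail12 Δ[H] (H ⊗ R) ≫
      tail21 ((β_ H H).inv ≫ inv 𝒮[H] ▷ H ≫ μ[H]) (H ⊗ H ⊗ R) ≫ bi H H (H ⊗ R) ≫
        H ◁ tail21 μ[H] R ≫ tail21 μ[H] R = H ◁ tail10 ε[H] (H ⊗ R) ≫ tail21 μ[H] R := by
    simp only [Category.assoc, ← bi_tail21, ← tail21_comp_left]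
    rw [e2 (biL21 ..), Category.assoc, Category.assoc, tail_mul_assoc,
      e2 (ex11 (inv 𝒮[H]) (bi H H (H ⊗ R))), Category.assoc, e3 (biR12 ..), Category.assoc,
      e2 (tail_mul_assoc ..), Category.assoc, e4 (tail_invAntipode_left ..), Category.assoc,
      e2 (tail_one_mul ..), Category.id_comp, e2 (biR10 ..)]
  rw [projTail, whiskerLeft_loop, loop_comp, comp_loop]
  simp only [whiskerLeft_comp, Category.assoc]
  rw [key, ← comp_loop, ← loop_slide_mul, comp_loop, reassoc_of% key2, ← comp_loop]

/-- Here `tail_comul_mul_eq` places the coaction (S ⊗ 1)Δ at the input of the loop. Carried around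
to the output it passes S⁻², and S⁻¹(u₂)u₁ = ε(u) leaves only the unit on the new strand. -/
lemma projTail_integral_on :
    tail12 Δ[H] R ≫ H ◁ projTail D H R = projTail D H R ≫ tail01 η[H] (H ⊗ R) := by
  have key : H ◁ tail12 Δ[H] R ≫ br H H (H ⊗ R) ≫ H ◁ tail21 μ[H] R ≫ H ◁ tail12 Δ[H] R ≫
      H ◁ invSq H ▷ (H ⊗ R) ≫ bi H H (H ⊗ R) =
      tail12 (Δ[H] ≫ 𝒮[H] ▷ H) (H ⊗ R) ≫ H ◁ (tail21 μ[H] R ≫ tail12 Δ[H] R ≫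
        H ◁ tail12 Δ[H] R ≫ H ◁ invSq H ▷ (H ⊗ R) ≫ bi H H (H ⊗ R)) ≫ bi H H (H ⊗ H ⊗ R) ≫
        H ◁ tail21 μ[H] (H ⊗ R) := by
    rw [e3 (tail_comul_mul_eq ..)]
    simp only [whiskerLeft_comp, Category.assoc, ← tail12_comp_left]
    rw [← biL21, e2 (ex21 μ[H] (invSq H ▷ (H ⊗ R))).symm, Category.assoc,
      e2 (ex21 μ[H] (tail12 Δ[H] R)).symm, Category.assoc]
  have key2 : tail12 Δ[H] R ≫ H ◁ tail12 Δ[H] R ≫ H ◁ invSq H ▷ (H ⊗ R) ≫ bi H H (H ⊗ R) ≫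
      tail12 (Δ[H] ≫ 𝒮[H] ▷ H) (H ⊗ H ⊗ R) ≫ br H H (H ⊗ H ⊗ R) ≫ H ◁ tail21 μ[H] (H ⊗ R) =
      tail12 Δ[H] R ≫ invSq H ▷ (H ⊗ R) ≫ H ◁ tail01 η[H] (H ⊗ R) := by
    have yb := biL22 H (H ⊗ R) (β_ H H).inv
    change bi H H _ ≫ _ = _ ≫ _ ≫ _ ◁ bi H H _ at yb
    simp only [← tail12_comp_left, Category.assoc]
    rw [e2 (biR11 ..), Category.assoc, e2 (tail_invSq_comul ..)]
    simp only [Category.assoc]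
    rw [e2 (ex11 𝒮[H] (invSq H ▷ (H ⊗ H ⊗ R))).symm, Category.assoc, ← comp_whiskerRight_assoc,
      invSq_antipode, e2 (brR11 ..), Category.assoc, e2 (brL11 ..), Category.assoc,
      e2 (bi_br ..), Category.id_comp]
    have hg : bi H H (H ⊗ R) ≫ inv 𝒮[H] ▷ (H ⊗ H ⊗ R) ≫ tail21 μ[H] (H ⊗ R) =
        tail21 ((β_ H H).inv ≫ inv 𝒮[H] ▷ H ≫ μ[H]) (H ⊗ R) := by
      rw [tail21_comp_left, bi_tail21]
    rw [e2 (biR12 H (H ⊗ R) Δ[H]).symm]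
    simp only [Category.assoc]
    rw [e3 yb, ex11 (invSq H)]
    simp only [Category.assoc]
    rw [w3 hg, e3 (biL21 H (H ⊗ R) _).symm, e2 (tail_comul_assoc ..), Category.assoc,
      e2 (tail_comul_assoc ..), Category.assoc, Category.assoc, ← bi_tail21, ← tail21_comp_left]
    simp only [Category.assoc]
    rw [e4 (tail_invAntipode_right ..), Category.assoc, e2 (tail_counit_comul ..),
      Category.id_comp, e2 (biL01 ..), ex11]
  rw [projTail, whiskerLeft_loop', comp_loop, loop_comp]
  simp only [whiskerLeft_comp, Category.assoc]
  have slide := congrArg (· ≫ tail21 μ[H] (H ⊗ R)) (loop_slide_comul (D := D) (Δ[H] ≫ 𝒮[H] ▷ H)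
    (tail21 μ[H] R ≫ tail12 Δ[H] R ≫ H ◁ tail12 Δ[H] R ≫ H ◁ invSq H ▷ (H ⊗ R) ≫
      bi H H (H ⊗ R)))
  simp only [loop_comp, Category.assoc] at slide
  rw [key, ← slide, key2]

/-- On an integral the loop variable enters only through the counit, so `loop_counit` opens the
loop. -/
lemma comp_projTail_of_integral {X : C} (f : X ⟶ H) (hf : IsLeftIntegralIn f) :
    f ▷ R ≫ projTail D H R = f ▷ R := by
  have h : H ◁ f ▷ R ≫ tail21 μ[H] R = tail10 ε[H] (X ⊗ R) ≫ f ▷ R := by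
    rw [tail21_comp_right, hf]; simp [tail21, tail10]
  have h2 : H ◁ f ▷ R ≫ tail21 μ[H] R ≫ tail12 Δ[H] R ≫ invSq H ▷ (H ⊗ R) =
      tail10 ε[H] (X ⊗ R) ≫ f ▷ R ≫ tail12 Δ[H] R ≫ invSq H ▷ (H ⊗ R) := by
    rw [e2 h, Category.assoc]
  rw [projTail, comp_loop, h2, loop_counit]
  simp only [Category.assoc]
  rw [comp_tail10, invSq_counit, tail_counit_comul, Category.comp_id]

/-- After an integral on `H` the looped output is S⁻²(1) = 1, so `loop_unit` opens the loop. -/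
lemma projTail_comp_of_integral {X : C} (f : H ⟶ X) (hf : IsLeftIntegralOn f) :
    projTail D H R ≫ f ▷ R = f ▷ R := by
  have h : tail12 Δ[H] R ≫ H ◁ f ▷ R = f ▷ R ≫ tail01 η[H] (X ⊗ R) := by
    rw [tail12_comp_right, hf]; simp [tail12, tail01]
  rw [projTail, loop_comp]
  simp only [Category.assoc]
  rw [ex11, e2 h, Category.assoc, tail01_comp, one_invSq, ← Category.assoc, loop_unit,
    e2 (tail_one_mul ..), Category.id_comp]

/-! ### The trace of the projection -/

/-- The trace of the projection composed with the inverse antipode is `1`. -/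
lemma loop_invAntipode_projTail : loop D (inv 𝒮[H] ▷ R ≫ projTail D H R) = 𝟙 R := by
  have hm : H ◁ inv 𝒮[H] ▷ R ≫ tail21 μ[H] R = tail21 (H ◁ inv 𝒮[H] ≫ μ[H]) R :=
    tail21_comp_right _ _ _
  -- In Sweedler notation, S⁻²(u₁)S⁻¹(u₂) = S⁻¹(u₂S⁻¹(u₁)) = ε(u)1.
  have key : tail12 Δ[H] R ≫ invSq H ▷ (H ⊗ R) ≫ bi H H R ≫ bi H H R ≫
      tail21 (H ◁ inv 𝒮[H] ≫ μ[H]) R = tail10 ε[H] R ≫ tail01 η[H] R := by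
    have h : invSq H ▷ (H ⊗ R) = inv 𝒮[H] ▷ (H ⊗ R) ≫ inv 𝒮[H] ▷ (H ⊗ R) := by simp [invSq]
    rw [← hm, e2 (biL11 ..), Category.assoc, e2 (biR11 ..), Category.assoc, h, Category.assoc,
      e2 (biR11 ..).symm, Category.assoc, ← tail_mul_invAntipode, e2 (biL11 ..).symm,
      Category.assoc, e4 (tail_invAntipode_left ..), Category.assoc, tail01_comp,
      one_invAntipode]
  simp only [projTail, loop, whiskerLeft_comp, Category.assoc]
  -- The product at the two coevaluations becomes, through its mate on `D`, a product of the two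
  -- outputs at the evaluations. A single loop remains; by `key` it is the trace of the counit
  -- followed by the unit, which is 1.
  rw [nested_crossedEval, ← whiskerLeft_comp_assoc, ← ex02, whiskerLeft_comp, Category.assoc,
    ww2 hm, e3 (coeval_mate22 ..)]
  simp only [Category.assoc]
  rw [e2 (ex12 _ _), Category.assoc, e2 (ex12 _ _), Category.assoc, e2 (ex12 _ _), Category.assoc,
    e2 (ex12 _ _), Category.assoc, e3 (biL12 ..), Category.assoc, w3 (biL12 ..), whiskerLeft_comp,
    Category.assoc, mate22_eval, e3 (biR21 ..).symm, Category.assoc, ← tail20_crossedEval,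
    ← whiskerLeft_comp_assoc, ← whiskerLeft_comp_assoc, ← whiskerLeft_comp_assoc,
    ← whiskerLeft_comp_assoc]
  simp only [Category.assoc]
  rw [key]
  have := loop_counit (D := D) ε[H] (tail01 η[H] R)
  rw [loop, whiskerLeft_comp] at this
  simp only [Category.assoc, whiskerLeft_comp] at this ⊢
  rw [this, tail_one_counit]

end Projection
end BraidedIntegral

/-! ### Opposite Hopf algebras and the reversed braiding -/

namespace BraidedIntegral
section Opposites

variable {C : Type u} [Category.{v} C] [MonoidalCategory C]

section Untail

variable {X Y Z W : C}

lemma eq_of_whiskerRight_unit {f g : X ⟶ Y} (h : f ▷ 𝟙_ C = g ▷ 𝟙_ C) : f = g :=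
  MonoidalCategory.whiskerRight_iff .. |>.mp h

lemma eq_of_tail22 {f g : X ⊗ Y ⟶ Z ⊗ W} (h : tail22 f (𝟙_ C) = tail22 g (𝟙_ C)) : f = g := by
  apply eq_of_whiskerRight_unit
  simpa only [tail22, cancel_mono, cancel_epi] using h

section
variable (H : C)

lemma mul_assoc_of_tail {m : H ⊗ H ⟶ H}
    (h : H ◁ tail21 m (𝟙_ C) ≫ tail21 m (𝟙_ C) = tail21 m (H ⊗ 𝟙_ C) ≫ tail21 m (𝟙_ C)) :
    m ▷ H ≫ m = (α_ H H H).hom ≫ H ◁ m ≫ m := by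
  apply eq_of_whiskerRight_unit
  calc _ = 𝟙 _ ⊗≫ (tail21 m (H ⊗ 𝟙_ C) ≫ tail21 m (𝟙_ C)) := by
        rw [tail21, tail21]; monoidal
    _ = _ := by rw [← h, tail21]; monoidal

lemma comul_assoc_of_tail {d : H ⟶ H ⊗ H}
    (h : tail12 d (𝟙_ C) ≫ H ◁ tail12 d (𝟙_ C) = tail12 d (𝟙_ C) ≫ tail12 d (H ⊗ 𝟙_ C)) :
    d ≫ H ◁ d = d ≫ d ▷ H ≫ (α_ H H H).hom := by
  apply eq_of_whiskerRight_unit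
  calc _ = (tail12 d (𝟙_ C) ≫ H ◁ tail12 d (𝟙_ C)) ⊗≫ 𝟙 _ := by
        rw [tail12]; monoidal
    _ = _ := by rw [h, tail12, tail12]; monoidal

end

end Untail

variable [BraidedCategory C] (H : C)

lemma bi_yang_baxter (R : C) :
    bi H H (H ⊗ R) ≫ H ◁ bi H H R ≫ bi H H (H ⊗ R) =
      H ◁ bi H H R ≫ bi H H (H ⊗ R) ≫ H ◁ bi H H R :=
  biL22 H R (β_ H H).inv

lemma bi_mul_assoc [MonObj H] (R : C) :
    H ◁ tail21 ((β_ H H).inv ≫ μ[H]) R ≫ tail21 ((β_ H H).inv ≫ μ[H]) R =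
      tail21 ((β_ H H).inv ≫ μ[H]) (H ⊗ R) ≫ tail21 ((β_ H H).inv ≫ μ[H]) R := by
  simp only [← bi_tail21, whiskerLeft_comp, Category.assoc]
  rw [e2 (biL21 ..), e2 (biR21 ..)]
  simp only [Category.assoc]
  rw [tail_mul_assoc, reassoc_of% bi_yang_baxter]

lemma comul_bi_assoc [ComonObj H] (R : C) :
    tail12 (Δ[H] ≫ (β_ H H).inv) R ≫ H ◁ tail12 (Δ[H] ≫ (β_ H H).inv) R =
      tail12 (Δ[H] ≫ (β_ H H).inv) R ≫ tail12 (Δ[H] ≫ (β_ H H).inv) (H ⊗ R) := by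
  simp only [← tail12_bi, whiskerLeft_comp, Category.assoc]
  rw [e2 (biL12 ..).symm, e2 (biR12 ..).symm]
  simp only [Category.assoc]
  rw [e2 (tail_comul_assoc ..), Category.assoc, bi_yang_baxter]

variable [HopfObj H]

/-- The crossing in the bialgebra axiom cancels against an inverse crossing, and another inverse
crossing takes its place; this is why the braiding must be reversed. -/
lemma mul_comul_bi (R : C) :
    tail21 μ[H] R ≫ tail12 (Δ[H] ≫ (β_ H H).inv) R =
      H ◁ tail12 (Δ[H] ≫ (β_ H H).inv) R ≫ tail12 (Δ[H] ≫ (β_ H H).inv) (H ⊗ H ⊗ R) ≫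
        H ◁ bi H H (H ⊗ R) ≫ tail21 μ[H] (H ⊗ H ⊗ R) ≫ H ◁ tail21 μ[H] R := by
  simp only [← tail12_bi, whiskerLeft_comp, Category.assoc]
  rw [e2 (tail_mul_comul ..)]
  simp only [Category.assoc]
  rw [biR21, e2 (biL21 ..)]
  simp only [Category.assoc]
  rw [w2 (br_bi ..), whiskerLeft_id, Category.id_comp, w2 (biL21 ..)]
  simp only [whiskerLeft_comp, Category.assoc]
  rw [← ex21, e2 (bi_ex _), Category.assoc, e2 (ex12 _ _), Category.assoc]

lemma bi_mul_comul (R : C) :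
    tail21 ((β_ H H).inv ≫ μ[H]) R ≫ tail12 Δ[H] R =
      H ◁ tail12 Δ[H] R ≫ tail12 Δ[H] (H ⊗ H ⊗ R) ≫ H ◁ bi H H (H ⊗ R) ≫
        tail21 ((β_ H H).inv ≫ μ[H]) (H ⊗ H ⊗ R) ≫ H ◁ tail21 ((β_ H H).inv ≫ μ[H]) R := by
  simp only [← bi_tail21, whiskerLeft_comp, Category.assoc]
  rw [tail_mul_comul, e2 (ex21 _ _), Category.assoc, e2 (bi_ex _), Category.assoc,
    e2 (biL12 ..).symm]
  simp only [Category.assoc]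
  rw [e2 (biR12 ..).symm]
  simp only [Category.assoc]
  rw [w2 (bi_br ..), whiskerLeft_id, Category.id_comp, w2 (biR12 ..).symm]
  simp only [whiskerLeft_comp, Category.assoc]
  rw [e2 (ex12 _ _), Category.assoc]

/-- The multiplication opposite to that of `H`. -/
abbrev opMon : MonObj H where
  one := η[H]
  mul := (β_ H H).inv ≫ μ[H]
  one_mul := by simp
  mul_one := by simp
  mul_assoc := mul_assoc_of_tail H (bi_mul_assoc H _)

lemma comul_bi_counit_left : (Δ[H] ≫ (β_ H H).inv) ≫ ε[H] ▷ H = (λ_ H).inv := by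
  have h : (β_ H H).inv ≫ ε[H] ▷ H = H ◁ ε[H] ≫ (β_ (𝟙_ C) H).inv :=
    (@BraidedCategory.braiding_naturality_right _ _ _ (reverseBraiding C) H _ _ ε[H]).symm
  rw [Category.assoc, h]; simp

lemma comul_bi_counit_right : (Δ[H] ≫ (β_ H H).inv) ≫ H ◁ ε[H] = (ρ_ H).inv := by
  have h : (β_ H H).inv ≫ H ◁ ε[H] = ε[H] ▷ H ≫ (β_ H (𝟙_ C)).inv :=
    (@BraidedCategory.braiding_naturality_left _ _ _ (reverseBraiding C) _ _ ε[H] H).symm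
  rw [Category.assoc, h]; simp

/-- The comultiplication opposite to that of `H`. -/
abbrev copComon : ComonObj H where
  counit := ε[H]
  comul := Δ[H] ≫ (β_ H H).inv
  counit_comul := comul_bi_counit_left H
  comul_counit := comul_bi_counit_right H
  comul_assoc := comul_assoc_of_tail H (comul_bi_assoc H _)

/-- `H` with the opposite comultiplication, as a bimonoid for the reversed braiding. -/
noncomputable abbrev copBimon : @BimonObj C _ _ (reverseBraiding C) H :=
  @BimonObj.mk C _ _ (reverseBraiding C) H inferInstance (copComon H)
    (by
      apply eq_of_tail22
      rw [@tail22_tensorμ _ _ _ H (reverseBraiding C), ← tail21_tail12]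
      exact mul_comul_bi H _)
    (by
      have h := BimonObj.one_comul H
      rw [MonObj.tensorObj.one_def] at h
      change η[H] ≫ Δ[H] ≫ (β_ H H).inv = (λ_ (𝟙_ C)).inv ≫ (η[H] ⊗ₘ η[H])
      rw [reassoc_of% h, BraidedCategory.braiding_inv_naturality]
      simp [← unitors_inv_equal])
    (BimonObj.mul_counit H)
    (BimonObj.one_counit H)

/-- `H` with the opposite multiplication, as a bimonoid for the reversed braiding. -/
noncomputable abbrev opBimon : @BimonObj C _ _ (reverseBraiding C) H :=
  @BimonObj.mk C _ _ (reverseBraiding C) H (opMon H) inferInstance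
    (by
      apply eq_of_tail22
      rw [@tail22_tensorμ _ _ _ H (reverseBraiding C), ← tail21_tail12]
      exact bi_mul_comul H _)
    (BimonObj.one_comul H)
    (by
      have h := BimonObj.mul_counit H
      rw [Comon.tensorObj_counit] at h
      change ((β_ H H).inv ≫ μ[H]) ≫ ε[H] = (ε[H] ⊗ₘ ε[H]) ≫ (λ_ (𝟙_ C)).hom
      rw [Category.assoc, h, ← BraidedCategory.braiding_inv_naturality_assoc]
      simp [← unitors_inv_equal])
    (BimonObj.one_counit H)

variable [IsIso 𝒮[H]]

/-- `H` with the opposite comultiplication, a Hopf algebra for the reversed braiding. -/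
noncomputable abbrev copHopf : @HopfObj C _ _ (reverseBraiding C) H :=
  @HopfObj.mk C _ _ (reverseBraiding C) H (copBimon H) (inv 𝒮[H])
    (by
      change (Δ[H] ≫ (β_ H H).inv) ≫ inv 𝒮[H] ▷ H ≫ μ[H] = ε[H] ≫ η[H]
      rw [← invAntipode_right, Category.assoc, BraidedCategory.braiding_inv_naturality_right_assoc])
    (by
      change (Δ[H] ≫ (β_ H H).inv) ≫ H ◁ inv 𝒮[H] ≫ μ[H] = ε[H] ≫ η[H]
      rw [← invAntipode_left, Category.assoc, BraidedCategory.braiding_inv_naturality_left_assoc])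

/-- `H` with the opposite multiplication, a Hopf algebra for the reversed braiding. -/
noncomputable abbrev opHopf : @HopfObj C _ _ (reverseBraiding C) H :=
  @HopfObj.mk C _ _ (reverseBraiding C) H (opBimon H) (inv 𝒮[H])
    (invAntipode_left H) (invAntipode_right H)

end Opposites
end BraidedIntegral

/-! ### The four endomorphisms as projections -/

namespace BraidedIntegral
section Projections

variable {C : Type u} [Category.{v} C] [MonoidalCategory C]

section Mates

variable [RigidCategory C] (H R : C)

lemma leftMate_eval (f : H ⟶ H) :
    H ◁ leftAdjointMate f ▷ R ≫ tail20 (ε_ (ᘁH : C) H) R = f ▷ ((ᘁH : C) ⊗ R) ≫ tail20 (ε_ (ᘁH : C) H) R := by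
  have h := congrArg (· ▷ R) (leftAdjointMate_comp_evaluation f)
  calc _ = 𝟙 _ ⊗≫ (H ◁ leftAdjointMate f ≫ ε_ (ᘁH : C) H) ▷ R ⊗≫ 𝟙 _ := by rw [tail20]; monoidal
    _ = _ := by rw [h, tail20]; monoidal

lemma rightMate_eval (f : H ⟶ H) :
    (fᘁ) ▷ (H ⊗ R) ≫ tail20 (ε_ H Hᘁ) R = (Hᘁ : C) ◁ f ▷ R ≫ tail20 (ε_ H Hᘁ) R := by
  have h := congrArg (· ▷ R) (rightAdjointMate_comp_evaluation f)
  calc _ = 𝟙 _ ⊗≫ ((fᘁ) ▷ H ≫ ε_ H Hᘁ) ▷ R ⊗≫ 𝟙 _ := by rw [tail20]; monoidal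
    _ = _ := by rw [h, tail20]; monoidal

end Mates

variable [BraidedCategory C]

/-- `P` projects `H` onto a class `In` of morphisms into `H` along a class `On` of morphisms
from `H`, and belongs to both classes. -/
structure IsProjection (H : C) (On : ∀ {X : C}, (H ⟶ X) → Prop) (In : ∀ {X : C}, (X ⟶ H) → Prop)
    (P : H ⟶ H) : Prop where
  on : On P
  mem : In P
  comp_of_on : ∀ {X : C} (f : H ⟶ X), On f → P ≫ f = f
  of_in_comp : ∀ {X : C} (f : X ⟶ H), In f → f ≫ P = f

section Proj

variable (D H : C) [ExactPairing D H] [HopfObj H] [IsIso 𝒮[H]]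

/-- The projection onto the left integrals. -/
noncomputable def proj : H ⟶ H := (ρ_ H).inv ≫ projTail D H (𝟙_ C) ≫ (ρ_ H).hom

lemma proj_whiskerRight_unit : proj D H ▷ 𝟙_ C = projTail D H (𝟙_ C) := by simp [proj]

lemma proj_whiskerRight_unit_eq : proj D H ▷ 𝟙_ C =
    tail02 (η_ D H) (H ⊗ 𝟙_ C) ≫ D ◁ (tail21 μ[H] (𝟙_ C) ≫ tail12 Δ[H] (𝟙_ C) ≫
      invSq H ▷ (H ⊗ 𝟙_ C)) ≫ bi H D (H ⊗ 𝟙_ C) ≫ tail20 (ε_ D H) (H ⊗ 𝟙_ C) := by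
  rw [proj_whiskerRight_unit, projTail, loop, tail20_crossedEval]

lemma proj_isProjection :
    IsProjection H (fun f => IsLeftIntegralOn f) (fun f => IsLeftIntegralIn f) (proj D H) where
  on := by
    have h := projTail_integral_on D H (𝟙_ C)
    rw [← proj_whiskerRight_unit] at h
    apply eq_of_whiskerRight_unit
    rw [← cancel_mono (α_ _ _ _).hom]
    calc _ = _ := by rw [comp_whiskerRight, Category.assoc, whisker_assoc]; simp [tail12]
      _ = _ := h
      _ = _ := by simp only [tail01]; monoidal
  mem := by
    have h := projTail_integral_in D H (𝟙_ C)
    rw [← proj_whiskerRight_unit] at h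
    apply eq_of_whiskerRight_unit
    rw [← cancel_epi (α_ _ _ _).inv]
    calc _ = _ := by rw [comp_whiskerRight, whisker_assoc]; simp [tail21]
      _ = _ := h
      _ = _ := by simp only [tail10]; monoidal
  comp_of_on f hf := by
    apply eq_of_whiskerRight_unit
    rw [comp_whiskerRight, proj_whiskerRight_unit, projTail_comp_of_integral _ _ _ _ hf]
  of_in_comp f hf := by
    apply eq_of_whiskerRight_unit
    rw [comp_whiskerRight, proj_whiskerRight_unit, comp_projTail_of_integral _ _ _ _ hf]

end Proj

section LeftDual

variable [RigidCategory C] (H R : C) [HopfObj H]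

lemma piRL_whiskerRight : piRL H ▷ R =
    tail02 (η_ (ᘁH) H) (H ⊗ R) ≫ (ᘁH : C) ◁ tail21 μ[H] R ≫ (ᘁ(𝒮[H] ≫ 𝒮[H])) ▷ (H ⊗ R) ≫
      br (ᘁH) H R ≫ tail12 Δ[H] ((ᘁH : C) ⊗ R) ≫ H ◁ tail20 (ε_ (ᘁH) H) R := by
  simp only [piRL, tail02, tail21, br, tail12, tail20, tail22]
  monoidal

lemma piLR_whiskerRight : piLR H ▷ R =
    H ◁ tail02 (η_ H Hᘁ) R ≫ tail21 μ[H] ((Hᘁ : C) ⊗ R) ≫ H ◁ ((𝒮[H] ≫ 𝒮[H])ᘁ) ▷ R ≫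
      br H Hᘁ R ≫ (Hᘁ : C) ◁ tail12 Δ[H] R ≫ tail20 (ε_ H Hᘁ) (H ⊗ R) := by
  simp only [piLR, tail02, tail21, br, tail12, tail20, tail22]
  monoidal

variable [IsIso 𝒮[H]]

lemma piLL_whiskerRight : piLL H ▷ R =
    tail02 (η_ (ᘁH) H) (H ⊗ R) ≫ tail02 (η_ H Hᘁ) ((ᘁH : C) ⊗ H ⊗ H ⊗ R) ≫
      invSq H ▷ ((Hᘁ : C) ⊗ (ᘁH : C) ⊗ H ⊗ H ⊗ R) ≫
      H ◁ br Hᘁ (ᘁH) (H ⊗ H ⊗ R) ≫ H ◁ (ᘁH : C) ◁ (Hᘁ : C) ◁ tail21 μ[H] R ≫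
      H ◁ (ᘁH : C) ◁ (Hᘁ : C) ◁ tail12 Δ[H] R ≫
      tail20 (ε_ (ᘁH) H) ((Hᘁ : C) ⊗ H ⊗ H ⊗ R) ≫ tail20 (ε_ H Hᘁ) (H ⊗ R) := by
  simp only [piLL, tensorHom_def' (η_ H Hᘁ), MonoidalCategory.tensorHom_def, invSq, tail02, tail21, br, tail12, tail20, tail22]
  monoidal

lemma piRR_whiskerRight : piRR H ▷ R =
    H ◁ tail02 (η_ (ᘁH) H) R ≫ H ◁ tail02 (η_ H Hᘁ) ((ᘁH : C) ⊗ H ⊗ R) ≫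
      tail21 μ[H] ((Hᘁ : C) ⊗ (ᘁH : C) ⊗ H ⊗ R) ≫
      tail12 Δ[H] ((Hᘁ : C) ⊗ (ᘁH : C) ⊗ H ⊗ R) ≫
      H ◁ H ◁ br Hᘁ (ᘁH) (H ⊗ R) ≫ H ◁ H ◁ (ᘁH : C) ◁ (Hᘁ : C) ◁ invSq H ▷ R ≫
      H ◁ tail20 (ε_ (ᘁH) H) ((Hᘁ : C) ⊗ H ⊗ R) ≫ H ◁ tail20 (ε_ H Hᘁ) R := by
  simp only [piRR, tensorHom_def' (η_ H Hᘁ), MonoidalCategory.tensorHom_def, invSq, tail02, tail21, br, tail12, tail20, tail22]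
  monoidal

end LeftDual

section Identification

variable (H R : C)

lemma tail02_br_bi {E : C} (f : 𝟙_ C ⟶ H ⊗ E) :
    tail02 f (H ⊗ R) ≫ br H E (H ⊗ R) ≫ E ◁ bi H H R =
      H ◁ tail02 f R ≫ H ◁ br H E R ≫ br H E (H ⊗ R) := by
  have h : bi H H (E ⊗ R) ≫ H ◁ br H E R ≫ br H E (H ⊗ R) =
      H ◁ br H E R ≫ br H E (H ⊗ R) ≫ E ◁ bi H H R := brL22 E R (β_ H H).inv
  rw [← brR02]
  simp only [Category.assoc]
  rw [← h, e2 (br_bi ..), Category.id_comp]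

lemma tail02_bi_br {E : C} (f : 𝟙_ C ⟶ H ⊗ E) :
    tail02 f (H ⊗ R) ≫ bi E H (H ⊗ R) ≫ E ◁ br H H R =
      H ◁ tail02 f R ≫ H ◁ bi E H R ≫ bi E H (H ⊗ R) :=
  @tail02_br_bi _ _ _ (reverseBraiding C) ..

variable [RigidCategory C] [HopfObj H]

/-- This is the loop of `copHopf H` for the reversed braiding: the antipode there is S⁻¹, so its
`invSq` is S², the square whose transpose enters `piRL`. Similarly, `piLR_loop` belongs to `opHopf`
and `piRR_loop` to `opCopHopf`. -/
lemma piRL_loop : piRL H ▷ R =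
    tail02 (η_ (ᘁH) H) (H ⊗ R) ≫ (ᘁH : C) ◁ (tail21 μ[H] R ≫ tail12 (Δ[H] ≫ (β_ H H).inv) R ≫
      (𝒮[H] ≫ 𝒮[H]) ▷ (H ⊗ R)) ≫ br (ᘁH) H (H ⊗ R) ≫ tail20 (ε_ (ᘁH) H) (H ⊗ R) := by
  have h : br (ᘁH) H (H ⊗ R) ≫ H ◁ br (ᘁH) H R ≫ H ◁ tail20 (ε_ (ᘁH) H) R =
      (ᘁH : C) ◁ bi H H R ≫ br (ᘁH) H (H ⊗ R) ≫ tail20 (ε_ (ᘁH) H) (H ⊗ R) := by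
    have ht (R : C) : tail20 ((β_ (ᘁH) H).hom ≫ ε_ (ᘁH) H) R =
        br (ᘁH) H R ≫ tail20 (ε_ (ᘁH) H) R := by simp [tail20, br, tail22]
    rw [← ht, ← brL20, w2 (bi_br ..), whiskerLeft_id, Category.id_comp, ht, whiskerLeft_comp]
  rw [piRL_whiskerRight, e2 (brL11 ..), Category.assoc, e2 (ex12 _ _).symm, Category.assoc,
    ← whiskerLeft_comp, leftMate_eval, e2 (brR12 ..).symm]
  simp only [Category.assoc, whiskerLeft_comp, ← tail12_bi]
  rw [w2 (brR11 ..).symm, whiskerLeft_comp, Category.assoc, e2 (br_ex _), Category.assoc, h]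
  rw [w2 (biR11 ..), whiskerLeft_comp, Category.assoc]

lemma piLR_loop : piLR H ▷ R =
    tail02 (η_ H Hᘁ) (H ⊗ R) ≫ br H Hᘁ (H ⊗ R) ≫
      (Hᘁ : C) ◁ (tail21 ((β_ H H).inv ≫ μ[H]) R ≫ tail12 Δ[H] R ≫
      (𝒮[H] ≫ 𝒮[H]) ▷ (H ⊗ R)) ≫ tail20 (ε_ H Hᘁ) (H ⊗ R) := by
  rw [piLR_whiskerRight, e2 (brR11 ..), Category.assoc, e2 (ex11 _ _), Category.assoc,
    rightMate_eval, e2 (brL21 ..)]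
  simp only [Category.assoc, whiskerLeft_comp, ← bi_tail21]
  rw [e3 (tail02_br_bi ..)]
  simp only [Category.assoc]

variable [IsIso 𝒮[H]]

/-- The strand through `Hᘁ` straightens by a zig-zag, which turns the braiding of the two duals into
the inverse braiding inside `crossedEval`. -/
lemma piLL_eq_proj : piLL H = proj (ᘁH) H := by
  have h (R : C) : tail02 (η_ H Hᘁ) ((ᘁH : C) ⊗ H ⊗ R) ≫
      invSq H ▷ ((Hᘁ : C) ⊗ (ᘁH : C) ⊗ H ⊗ R) ≫ H ◁ br Hᘁ (ᘁH) (H ⊗ R) ≫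
      tail20 (ε_ (ᘁH) H) ((Hᘁ : C) ⊗ H ⊗ R) ≫ tail20 (ε_ H Hᘁ) R =
      (ᘁH : C) ◁ invSq H ▷ R ≫ bi H (ᘁH) R ≫ tail20 (ε_ (ᘁH) H) R := by
    have h2 : br Hᘁ (ᘁH) (H ⊗ R) ≫ (ᘁH : C) ◁ tail20 (ε_ H Hᘁ) R =
        (Hᘁ : C) ◁ bi H (ᘁH) R ≫ tail20 (ε_ H Hᘁ) ((ᘁH : C) ⊗ R) := by
      rw [← brL20, w2 (bi_br ..), whiskerLeft_id, Category.id_comp]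
    rw [ex20, w2 h2, e2 (biR11 ..), whiskerLeft_comp, Category.assoc, e2 (ex11 _ _),
      Category.assoc, e2 (ex11 _ _), Category.assoc, e2 (ex02 _ _), Category.assoc,
      e2 (zigzag_left _), Category.id_comp, Category.assoc]
  apply eq_of_whiskerRight_unit
  rw [proj_whiskerRight_unit, piLL_whiskerRight, projTail, loop, tail20_crossedEval]
  simp only [whiskerLeft_comp, Category.assoc]
  rw [← h, e2 (ex02 (η_ H Hᘁ) ((ᘁH : C) ◁ tail12 Δ[H] (𝟙_ C))).symm, Category.assoc,
    e2 (ex02 (η_ H Hᘁ) ((ᘁH : C) ◁ tail21 μ[H] (𝟙_ C))).symm, Category.assoc,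
    e2 (ex11 _ _).symm, Category.assoc, e2 (ex11 _ _).symm, Category.assoc,
    w2 (br_ex _).symm, whiskerLeft_comp, Category.assoc, w2 (br_ex _).symm, whiskerLeft_comp,
    Category.assoc]

lemma piRR_loop : piRR H ▷ R =
    tail02 (η_ H Hᘁ) (H ⊗ R) ≫ bi Hᘁ H (H ⊗ R) ≫
      (Hᘁ : C) ◁ (tail21 ((β_ H H).hom ≫ μ[H]) R ≫ tail12 (Δ[H] ≫ (β_ H H).inv) R ≫
      invSq H ▷ (H ⊗ R)) ≫ tail20 (ε_ H Hᘁ) (H ⊗ R) := by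
  have h : H ◁ tail20 (ε_ H Hᘁ) R = bi Hᘁ H (H ⊗ R) ≫ (Hᘁ : C) ◁ bi H H R ≫
      tail20 (ε_ H Hᘁ) (H ⊗ R) := by
    rw [← brL20, w2 (bi_br ..), whiskerLeft_id, Category.id_comp, e2 (bi_br ..), Category.id_comp]
  have h2 : (Hᘁ : C) ◁ tail02 (η_ (ᘁH) H) R ≫ br Hᘁ (ᘁH) (H ⊗ R) =
      tail02 (η_ (ᘁH) H) ((Hᘁ : C) ⊗ R) ≫ (ᘁH : C) ◁ bi Hᘁ H R := by
    rw [← brR02, Category.assoc, Category.assoc, ← whiskerLeft_comp, br_bi]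
    simp
  have h3 : H ◁ (Hᘁ : C) ◁ tail02 (η_ (ᘁH) H) R ≫ H ◁ br Hᘁ (ᘁH) (H ⊗ R) ≫
      tail20 (ε_ (ᘁH) H) ((Hᘁ : C) ⊗ H ⊗ R) = bi Hᘁ H R := by
    rw [w2 h2, whiskerLeft_comp, Category.assoc, ← ex20, e2 (zigzag_right _), Category.id_comp]
  rw [piRR_whiskerRight, w2 (ex02 _ _).symm, whiskerLeft_comp, Category.assoc,
    e2 (ex21 _ _).symm, Category.assoc, e2 (ex12 _ _).symm, Category.assoc,
    w2 (ex20 _ _).symm, whiskerLeft_comp, Category.assoc, w3 h3, h, e2 (bi_ex _).symm, Category.assoc,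
    w2 (biR11 ..), whiskerLeft_comp, Category.assoc, e3 (biL12 ..), Category.assoc, e2 (biL21 ..)]
  simp only [Category.assoc, whiskerLeft_comp, ← br_tail21, ← tail12_bi]
  rw [e3 (tail02_bi_br ..)]
  simp only [Category.assoc]

end Identification

section Sides

/-- Only integrals on `H` change sides here, since `copBimon` keeps the multiplication and counit;
dually, `opBimon` leaves integrals on `H` untouched. -/
lemma isLeftIntegralOn_copBimon (H : C) [HopfObj H] {X : C} (f : H ⟶ X) :
    @IsLeftIntegralOn C _ _ (reverseBraiding C) H (copBimon H) X f ↔ IsRightIntegralOn f := by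
  change (Δ[H] ≫ (β_ H H).inv) ≫ H ◁ f = f ≫ (λ_ X).inv ≫ η[H] ▷ X ↔
    Δ[H] ≫ f ▷ H = f ≫ (ρ_ X).inv ≫ X ◁ η[H]
  rw [← cancel_mono (β_ H X).inv]
  simp only [Category.assoc, BraidedCategory.braiding_inv_naturality_left,
    BraidedCategory.braiding_inv_naturality_right, braiding_inv_tensorUnit_left,
    Iso.inv_hom_id_assoc]

lemma isLeftIntegralIn_opBimon (H : C) [HopfObj H] {X : C} (f : X ⟶ H) :
    @IsLeftIntegralIn C _ _ (reverseBraiding C) H (opBimon H) X f ↔ IsRightIntegralIn f := by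
  change H ◁ f ≫ (β_ H H).inv ≫ μ[H] = ε[H] ▷ X ≫ (λ_ X).hom ≫ f ↔
    f ▷ H ≫ μ[H] = X ◁ ε[H] ≫ (ρ_ X).hom ≫ f
  rw [← cancel_epi (β_ X H).inv, BraidedCategory.braiding_inv_naturality_right_assoc,
    ← BraidedCategory.braiding_inv_naturality_left_assoc]
  simp

variable (H : C) [HopfObj H] [IsIso 𝒮[H]]

lemma invSq_copHopf : @invSq C _ _ H (reverseBraiding C) (copHopf H)
    (inferInstanceAs (IsIso (inv 𝒮[H]))) = 𝒮[H] ≫ 𝒮[H] := by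
  change @inv _ _ _ _ (inv 𝒮[H]) _ ≫ @inv _ _ _ _ (inv 𝒮[H]) _ = _
  simp

lemma invSq_opHopf : @invSq C _ _ H (reverseBraiding C) (opHopf H)
    (inferInstanceAs (IsIso (inv 𝒮[H]))) = 𝒮[H] ≫ 𝒮[H] := by
  change @inv _ _ _ _ (inv 𝒮[H]) _ ≫ @inv _ _ _ _ (inv 𝒮[H]) _ = _
  simp

/-- `H` with the opposite multiplication and comultiplication. -/
noncomputable abbrev opCopHopf : HopfObj H :=
  @opHopf C _ _ (reverseBraiding C) H (copHopf H) (inferInstanceAs (IsIso (inv 𝒮[H])))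

lemma opCopHopf_antipode : @HopfObj.antipode C _ _ _ H (opCopHopf H) = 𝒮[H] := by
  change @inv _ _ _ _ (inv 𝒮[H]) _ = _
  simp

lemma isIso_opCopHopf_antipode : IsIso (@HopfObj.antipode C _ _ _ H (opCopHopf H)) := by
  rw [opCopHopf_antipode]; infer_instance

lemma invSq_opCopHopf : @invSq C _ _ H _ (opCopHopf H) (isIso_opCopHopf_antipode H) = invSq H := by
  simp only [invSq, opCopHopf_antipode]

variable [RigidCategory C]

lemma piLL_isProjection :
    IsProjection H (fun f => IsLeftIntegralOn f) (fun f => IsLeftIntegralIn f) (piLL H) :=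
  piLL_eq_proj H ▸ proj_isProjection (ᘁH) H

lemma piRL_eq_proj : piRL H = @proj C _ _ (reverseBraiding C) (ᘁH) H _ (copHopf H)
    (inferInstanceAs (IsIso (inv 𝒮[H]))) := by
  apply eq_of_whiskerRight_unit
  refine (piRL_loop H _).trans (Eq.trans ?_
    (@proj_whiskerRight_unit_eq C _ _ (reverseBraiding C) (ᘁH) H _ (copHopf H)
      (inferInstanceAs (IsIso (inv 𝒮[H])))).symm)
  rw [invSq_copHopf]
  rfl

lemma piRL_isProjection :
    IsProjection H (fun f => IsRightIntegralOn f) (fun f => IsLeftIntegralIn f) (piRL H) := by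
  have h := @proj_isProjection C _ _ (reverseBraiding C) (ᘁH) H _ (copHopf H)
    (inferInstanceAs (IsIso (inv 𝒮[H])))
  rw [← piRL_eq_proj] at h
  simp only [isLeftIntegralOn_copBimon] at h
  exact h

/-- The pairing of `Hᘁ` has the wrong handedness for `proj` and is swapped by the braiding; the
crossing this puts in the evaluation cancels that of `crossedEval`. -/
lemma piLR_eq_proj : piLR H = @proj C _ _ (reverseBraiding C) Hᘁ H
    (@BraidedCategory.exactPairing_swap C _ _ (reverseBraiding C) H Hᘁ _) (opHopf H)
    (inferInstanceAs (IsIso (inv 𝒮[H]))) := by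
  apply eq_of_whiskerRight_unit
  refine (piLR_loop H _).trans (Eq.trans ?_
    (@proj_whiskerRight_unit_eq C _ _ (reverseBraiding C) Hᘁ H
      (@BraidedCategory.exactPairing_swap C _ _ (reverseBraiding C) H Hᘁ _) (opHopf H)
      (inferInstanceAs (IsIso (inv 𝒮[H])))).symm)
  rw [invSq_opHopf]
  have h (R : C) : @bi C _ _ (reverseBraiding C) H Hᘁ R ≫ tail20 (@ExactPairing.evaluation C _ _ Hᘁ H
      (@BraidedCategory.exactPairing_swap C _ _ (reverseBraiding C) H Hᘁ _)) R =
      tail20 (ε_ H Hᘁ) R := by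
    change tail22 (β_ Hᘁ H).hom R ≫ tail20 ((β_ Hᘁ H).inv ≫ ε_ H Hᘁ) R = _
    simp [tail22, tail20]
  have h' (R : C) : tail02 (@ExactPairing.coevaluation C _ _ Hᘁ H
      (@BraidedCategory.exactPairing_swap C _ _ (reverseBraiding C) H Hᘁ _)) R =
      tail02 (η_ H Hᘁ) R ≫ br H Hᘁ R := by
    change tail02 (η_ H Hᘁ ≫ (β_ H Hᘁ).hom) R = _
    simp [tail02, br, tail22]
  rw [h, h']
  simp only [Category.assoc]
  rfl

lemma piLR_isProjection :
    IsProjection H (fun f => IsLeftIntegralOn f) (fun f => IsRightIntegralIn f) (piLR H) := by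
  have h := @proj_isProjection C _ _ (reverseBraiding C) Hᘁ H
    (@BraidedCategory.exactPairing_swap C _ _ (reverseBraiding C) H Hᘁ _) (opHopf H)
    (inferInstanceAs (IsIso (inv 𝒮[H])))
  rw [← piLR_eq_proj] at h
  simp only [isLeftIntegralIn_opBimon] at h
  exact h

lemma piRR_eq_proj : piRR H = @proj C _ _ _ Hᘁ H
    (BraidedCategory.exactPairing_swap H Hᘁ) (opCopHopf H) (isIso_opCopHopf_antipode H) := by
  apply eq_of_whiskerRight_unit
  refine (piRR_loop H _).trans (Eq.trans ?_
    (@proj_whiskerRight_unit_eq C _ _ _ Hᘁ H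
      (BraidedCategory.exactPairing_swap H Hᘁ) (opCopHopf H) (isIso_opCopHopf_antipode H)).symm)
  rw [invSq_opCopHopf]
  have h (R : C) : bi H Hᘁ R ≫ tail20 (@ExactPairing.evaluation C _ _ Hᘁ H
      (BraidedCategory.exactPairing_swap H Hᘁ)) R =
      tail20 (ε_ H Hᘁ) R := by
    change tail22 (β_ H Hᘁ).inv R ≫ tail20 ((β_ H Hᘁ).hom ≫ ε_ H Hᘁ) R = _
    simp [tail22, tail20]
  have h' (R : C) : tail02 (@ExactPairing.coevaluation C _ _ Hᘁ H
      (BraidedCategory.exactPairing_swap H Hᘁ)) R =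
      tail02 (η_ H Hᘁ) R ≫ bi Hᘁ H R := by
    change tail02 (η_ H Hᘁ ≫ (β_ Hᘁ H).inv) R = _
    simp [tail02, bi, tail22]
  rw [h, h']
  simp only [Category.assoc]
  rfl

lemma piRR_isProjection :
    IsProjection H (fun f => IsRightIntegralOn f) (fun f => IsRightIntegralIn f) (piRR H) := by
  have h := @proj_isProjection C _ _ _ Hᘁ H
    (BraidedCategory.exactPairing_swap H Hᘁ) (opCopHopf H) (isIso_opCopHopf_antipode H)
  rw [← piRR_eq_proj] at h
  have hi {X : C} (f : X ⟶ H) := @isLeftIntegralIn_opBimon C _ _ (reverseBraiding C) H (copHopf H) X f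
  exact ⟨(isLeftIntegralOn_copBimon H _).1 h.on, (hi _).1 h.mem,
    fun f hf => h.comp_of_on f ((isLeftIntegralOn_copBimon H _).2 hf),
    fun f hf => h.of_in_comp f ((hi _).2 hf)⟩

end Sides

end Projections
end BraidedIntegral

/-! ### Integral objects: scalars, traces and invertibility -/

namespace BraidedIntegral
section IntegralObjects

variable {C : Type u} [Category.{v} C] {H : C}

/-- A projection and universal morphisms of the two classes determine each other. -/
lemma IsProjection.exists_inverse {On : ∀ {X : C}, (H ⟶ X) → Prop}
    {In : ∀ {X : C}, (X ⟶ H) → Prop} {P : H ⟶ H} (hP : IsProjection H On In P) {K : C} {p : H ⟶ K}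
    {i : K ⟶ H} (hp : On p) (hi : In i) (hp' : ∀ (X : C) (f : H ⟶ X), On f → ∃! g : K ⟶ X, p ≫ g = f)
    (hi' : ∀ (X : C) (f : X ⟶ H), In f → ∃! h : X ⟶ K, h ≫ i = f) :
    ∃ r : K ⟶ K, (i ≫ p) ≫ r = 𝟙 K ∧ r ≫ i ≫ p = 𝟙 K ∧ P = p ≫ r ≫ i := by
  obtain ⟨g, hg, hg'⟩ := hp' _ _ hP.on
  obtain ⟨t, ht, -⟩ := hi' _ _ hP.mem
  have hPP : P ≫ P = P := hP.comp_of_on P hP.on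
  -- Since P is idempotent, `g` and `g ≫ P` are both factorizations of P through `p`, hence equal.
  have hr : g = (g ≫ t) ≫ i := by
    rw [Category.assoc, ht]
    exact (hg' (g ≫ P) (by simp only [← Category.assoc, hg, hPP])).symm
  have hP' : P = p ≫ (g ≫ t) ≫ i := by rw [← hr, hg]
  refine ⟨g ≫ t, ?_, ?_, hP'⟩
  · apply (hi' _ _ hi).unique _ (Category.id_comp i)
    conv_rhs => rw [← hP.of_in_comp i hi, hP']
    simp only [Category.assoc]
  · apply (hp' _ _ hp).unique _ (Category.comp_id p)
    conv_rhs => rw [← hP.comp_of_on p hp, hP']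
    simp only [Category.assoc]

variable [MonoidalCategory C]

section Scalar

variable {X Y Z : C}

lemma scalar_eq (c : 𝟙_ C ⟶ 𝟙_ C) (f : X ⟶ Y) :
    scalar c f = (λ_ X).inv ≫ c ▷ X ≫ (λ_ X).hom ≫ f := by
  simp [scalar, MonoidalCategory.tensorHom_def]

lemma scalar_comp (c : 𝟙_ C ⟶ 𝟙_ C) (f : X ⟶ Y) (g : Y ⟶ Z) :
    scalar c f ≫ g = scalar c (f ≫ g) := by
  simp [scalar_eq]

lemma comp_scalar (c : 𝟙_ C ⟶ 𝟙_ C) (f : X ⟶ Y) (g : Y ⟶ Z) :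
    f ≫ scalar c g = scalar c (f ≫ g) := by
  rw [scalar_eq, scalar_eq, ← leftUnitor_naturality_assoc, ← whisker_exchange_assoc,
    ← leftUnitor_inv_naturality_assoc]

lemma scalar_whiskerRight (c : 𝟙_ C ⟶ 𝟙_ C) (f : X ⟶ Y) (Z : C) :
    scalar c f ▷ Z = scalar c (f ▷ Z) := by
  simp only [scalar_eq]; monoidal

lemma scalar_scalar (c d : 𝟙_ C ⟶ 𝟙_ C) (f : X ⟶ Y) :
    scalar c (scalar d f) = scalar (c ≫ d) f := by
  simp [scalar_eq]

lemma scalar_id (f : X ⟶ Y) : scalar (𝟙 (𝟙_ C)) f = f := by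
  simp [scalar_eq]

lemma scalar_unit (c : 𝟙_ C ⟶ 𝟙_ C) : scalar c (𝟙 (𝟙_ C)) = c := by
  rw [scalar_eq, unitors_equal, rightUnitor_naturality_assoc, ← unitors_equal]
  simp

lemma scalar_splitting {H K : C} {p : H ⟶ K} {i : K ⟶ H} {r : K ⟶ K} {P : H ⟶ H} {c : Aut (𝟙_ C)}
    (hc : i ≫ p = scalar c.hom (𝟙 K)) (hr : (i ≫ p) ≫ r = 𝟙 K) (hP : P = p ≫ r ≫ i) :
    i ≫ scalar c.inv p = 𝟙 K ∧ scalar c.inv (p ≫ i) = P := by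
  have h : r = scalar c.inv (𝟙 K) := by
    rw [← hr, hc, scalar_comp, scalar_scalar, Category.id_comp, c.inv_hom_id, scalar_id]
  refine ⟨?_, ?_⟩
  · rw [comp_scalar, hc, scalar_scalar, c.inv_hom_id, scalar_id]
  · rw [hP, h, scalar_comp, comp_scalar, Category.id_comp]

/-- A scalar acting trivially on `X` acts trivially on retracts of `X`. -/
lemma scalar_retract {c : 𝟙_ C ⟶ 𝟙_ C} (h : scalar c (𝟙 X) = 𝟙 X) (i : Y ⟶ X) (p : X ⟶ Y)
    (hip : i ≫ p = 𝟙 Y) : scalar c (𝟙 Y) = 𝟙 Y := by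
  rw [← hip, ← comp_scalar, ← Category.id_comp p, ← scalar_comp, h, Category.id_comp]

lemma scalar_tensor {c : 𝟙_ C ⟶ 𝟙_ C} (h : scalar c (𝟙 X) = 𝟙 X) (Z : C) :
    scalar c (𝟙 (X ⊗ Z)) = 𝟙 (X ⊗ Z) := by
  rw [← id_whiskerRight, ← scalar_whiskerRight, h]

lemma scalar_tensor' [BraidedCategory C] {c : 𝟙_ C ⟶ 𝟙_ C} (h : scalar c (𝟙 X) = 𝟙 X) (Z : C) :
    scalar c (𝟙 (Z ⊗ X)) = 𝟙 (Z ⊗ X) :=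
  scalar_retract (scalar_tensor h Z) (β_ Z X).hom (β_ Z X).inv (by simp)

/-- Endomorphisms of an invertible object are scalars. -/
lemma exists_scalar {K : C} (hK : IsInvertibleObj K) (s : K ⟶ K) [IsIso s] :
    ∃ c : Aut (𝟙_ C), s = scalar c.hom (𝟙 K) := by
  obtain ⟨L, ⟨j⟩, ⟨k⟩⟩ := hK
  -- Tensoring with `L` loses nothing, since a further tensoring with `K` can be undone by L ⊗ K ≅
  -- 𝟙.
  have faithful {f g : K ⟶ K} (h : f ▷ L = g ▷ L) : f = g := by
    apply eq_of_whiskerRight_unit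
    have h2 : f ▷ (L ⊗ K) = g ▷ (L ⊗ K) := by
      rw [whiskerRight_tensor, whiskerRight_tensor, h]
    rw [← cancel_epi (K ◁ k.hom), whisker_exchange, h2, whisker_exchange]
  refine ⟨j.symm ≪≫ asIso (s ▷ L) ≪≫ j, faithful ?_⟩
  have h : s ▷ L = j.hom ≫ scalar (j.inv ≫ s ▷ L ≫ j.hom) (𝟙 _) ≫ j.inv := by
    simp [scalar_unit]
  refine h.trans ?_
  rw [scalar_whiskerRight, scalar_comp, comp_scalar]
  simp

end Scalar

section Trace

variable [BraidedCategory C] [RigidCategory C] {X Y : C}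

/-- The map `g` travels around the dual strand by transposition and naturality of the braiding; no
pivotal structure is involved. -/
lemma tr8_comp_comm (f : X ⟶ Y) (g : Y ⟶ X) : tr8 (f ≫ g) = tr8 (g ≫ f) := by
  simp only [tr8, comp_whiskerRight, Category.assoc]
  rw [BraidedCategory.braiding_naturality_left_assoc, ← rightAdjointMate_comp_evaluation,
    ← BraidedCategory.braiding_naturality_right_assoc, ← whisker_exchange_assoc,
    coevaluation_comp_rightAdjointMate_assoc]

lemma tr8_eq_dim8 {p : X ⟶ Y} {i : Y ⟶ X} {r : Y ⟶ Y} {P : X ⟶ X} (hr : (i ≫ p) ≫ r = 𝟙 Y)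
    (hP : P = p ≫ r ≫ i) : tr8 P = dim8 Y := by
  rw [hP, ← Category.assoc, tr8_comp_comm, ← Category.assoc, hr, dim8]

end Trace

section Integrals

variable {A B X : C} [BraidedCategory C]

lemma IsLeftIntegralOn.comp [BimonObj H] {f : H ⟶ A} (hf : IsLeftIntegralOn f) (g : A ⟶ B) :
    IsLeftIntegralOn (f ≫ g) := by
  rw [IsLeftIntegralOn, whiskerLeft_comp, reassoc_of% hf, ← whisker_exchange, Category.assoc,
    leftUnitor_inv_naturality_assoc g]

lemma IsRightIntegralOn.comp [BimonObj H] {f : H ⟶ A} (hf : IsRightIntegralOn f) (g : A ⟶ B) :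
    IsRightIntegralOn (f ≫ g) := by
  rw [IsRightIntegralOn, comp_whiskerRight, reassoc_of% hf, whisker_exchange, Category.assoc,
    rightUnitor_inv_naturality_assoc g]

lemma IsLeftIntegralIn.precomp [BimonObj H] {f : B ⟶ H} (hf : IsLeftIntegralIn f) (g : A ⟶ B) :
    IsLeftIntegralIn (g ≫ f) := by
  rw [IsLeftIntegralIn, whiskerLeft_comp, Category.assoc, hf, whisker_exchange_assoc,
    leftUnitor_naturality_assoc]

lemma IsRightIntegralIn.precomp [BimonObj H] {f : B ⟶ H} (hf : IsRightIntegralIn f) (g : A ⟶ B) :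
    IsRightIntegralIn (g ≫ f) := by
  rw [IsRightIntegralIn, comp_whiskerRight, Category.assoc, hf, ← whisker_exchange_assoc,
    rightUnitor_naturality_assoc]

variable [HopfObj H]

/-- Take a = x and b = y in `tail_comul_mul_eq` and apply `f` to the second leg. One side reduces to
y ⊗ f(x), the other to S(x) ⊗ f(y). -/
lemma tail_integrals_exchange {x : A ⟶ H} {y : B ⟶ H} {f : H ⟶ X} (hx : IsRightIntegralIn x)
    (hy : IsLeftIntegralIn y) (hf : IsLeftIntegralOn f) (R : C) :
    (x ≫ 𝒮[H]) ▷ (B ⊗ R) ≫ H ◁ (y ≫ f) ▷ R =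
      br A B R ≫ y ▷ (A ⊗ R) ≫ H ◁ (x ≫ f) ▷ R := by
  have hx' : x ▷ (H ⊗ R) ≫ tail21 μ[H] R = A ◁ tail10 ε[H] R ≫ x ▷ R := by
    rw [tail21_comp_left, hx]; simp only [tail21, tail10]; monoidal
  have hy' : H ◁ y ▷ R ≫ tail21 μ[H] R = tail10 ε[H] (B ⊗ R) ≫ y ▷ R := by
    rw [tail21_comp_right, hy]; simp [tail21, tail10]
  have hf' : tail12 Δ[H] R ≫ H ◁ f ▷ R = f ▷ R ≫ tail01 η[H] (X ⊗ R) := by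
    rw [tail12_comp_right, hf]; simp [tail12, tail01]
  calc
    _ = x ▷ (B ⊗ R) ≫ H ◁ y ▷ R ≫ tail12 Δ[H] (H ⊗ R) ≫ 𝒮[H] ▷ (H ⊗ H ⊗ R) ≫ H ◁ tail21 μ[H] R ≫
        H ◁ tail12 Δ[H] R ≫ tail21 μ[H] (H ⊗ R) ≫ H ◁ f ▷ R := by
      rw [ex21, w2 hf', e2 (ex12 _ _).symm, Category.assoc, e2 (ex11 _ _).symm, Category.assoc,
        w2 hy', whiskerLeft_comp, Category.assoc, e2 (ex11 _ _), Category.assoc,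
        e2 (tail_comul_counit ..), Category.id_comp, whiskerLeft_comp, Category.assoc,
        tail_mul_one, Category.comp_id, comp_whiskerRight, comp_whiskerRight, whiskerLeft_comp,
        Category.assoc]
    _ = x ▷ (B ⊗ R) ≫ H ◁ y ▷ R ≫ H ◁ tail12 Δ[H] R ≫ br H H (H ⊗ R) ≫ H ◁ tail21 μ[H] R ≫
        H ◁ f ▷ R := by
      rw [e3 (tail_comul_mul_eq ..)]
      simp only [Category.assoc]
    _ = _ := by
      rw [e2 (ex11 x _), Category.assoc, e2 (ex11 x _), Category.assoc, e2 (brL11 ..),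
        Category.assoc, w2 hx', whiskerLeft_comp, Category.assoc, e2 (br_ex _), Category.assoc,
        w2 (tail_comul_counit ..), whiskerLeft_id, Category.id_comp, e2 (brR11 ..), Category.assoc,
        comp_whiskerRight, whiskerLeft_comp]

/-- If the self-braiding of `K` decomposes into endomorphisms of the factors, and the unit object
is a retract of an object with a tensor factor `K`, then `K` is invertible. -/
lemma isInvertibleObj_of_braiding_eq [RigidCategory C] {K : C} (w c : K ⟶ K)
    (hβ : (β_ K K).hom = w ▷ K ≫ K ◁ c) {D : C} (a : 𝟙_ C ⟶ D ⊗ K) (b : D ⊗ K ⟶ 𝟙_ C)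
    (hab : a ≫ b = 𝟙 _) : IsInvertibleObj K := by
  let u : (Kᘁ : C) ⊗ K ⟶ 𝟙_ C := (Kᘁ : C) ◁ w ≫ ε_ K Kᘁ
  let r : 𝟙_ C ⟶ (Kᘁ : C) ⊗ K := η_ K Kᘁ ≫ c ▷ (Kᘁ : C) ≫ (β_ K Kᘁ).hom
  have hur : u ≫ r = 𝟙 _ := by
    have hβ' (R : C) : br K K R = w ▷ (K ⊗ R) ≫ K ◁ c ▷ R := by
      simp [br, tail22, hβ]
    -- Pulling the coevaluation through a strand `K`, with the crossing replaced by w ⊗ c, shows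
    -- that w ⊗ r merely inserts a coevaluation; evaluating then gives u ≫ r = 𝟙.
    have h := brR02 K (𝟙_ C) (η_ K (Kᘁ : C))
    rw [hβ', Category.assoc, e2 (ex11 w (tail02 (η_ K (Kᘁ : C)) (𝟙_ C))).symm, Category.assoc] at h
    have hr : tail02 r (𝟙_ C) = tail02 (η_ K (Kᘁ : C)) (𝟙_ C) ≫ c ▷ ((Kᘁ : C) ⊗ 𝟙_ C) ≫
        br K Kᘁ (𝟙_ C) := by simp [r, tail02, br, tail22]
    rw [← whiskerLeft_comp, ← whiskerLeft_comp, ← hr] at h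
    have h' := congrArg (fun k => (Kᘁ : C) ◁ k ≫ tail20 (ε_ K (Kᘁ : C)) ((Kᘁ : C) ⊗ K ⊗ 𝟙_ C)) h
    simp only [zigzag_right, whiskerLeft_comp, Category.assoc, ← ex20] at h'
    apply eq_of_tail22
    calc _ = (Kᘁ : C) ◁ w ▷ 𝟙_ C ≫ tail20 (ε_ K (Kᘁ : C)) (𝟙_ C) ≫ tail02 r (𝟙_ C) := by
          simp [u, tail22, tail20, tail02]
      _ = _ := by rw [h']; simp [tail22]
  -- The scalar `r ≫ u` acts trivially on Kᘁ ⊗ K, hence on its tensor multiples and on their retract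
  -- `K`, and finally on the unit by `hab`. The last step excludes cases such as a zero object.
  have hru : r ≫ u = 𝟙 _ := by
    have h1 : scalar (r ≫ u) (𝟙 ((Kᘁ : C) ⊗ K)) = 𝟙 _ := by
      have h : u ≫ scalar (r ≫ u) (𝟙 (𝟙_ C)) ≫ r = 𝟙 _ := by
        rw [scalar_unit, Category.assoc r u r, hur, Category.comp_id, hur]
      rwa [scalar_comp, comp_scalar, Category.id_comp, hur] at h
    have h2 : scalar (r ≫ u) (𝟙 K) = 𝟙 K := by
      refine scalar_retract (scalar_tensor' h1 K) ((λ_ K).inv ≫ η_ K Kᘁ ▷ K ≫ (α_ _ _ _).hom)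
        (K ◁ ε_ K Kᘁ ≫ (ρ_ K).hom) ?_
      simp
    have h3 := scalar_retract (scalar_tensor' h2 D) a b hab
    rwa [scalar_unit] at h3
  let e : (Kᘁ : C) ⊗ K ≅ 𝟙_ C := ⟨u, r, hur, hru⟩
  exact ⟨Kᘁ, ⟨β_ K Kᘁ ≪≫ e⟩, ⟨e⟩⟩

end Integrals

section Main

variable [BraidedCategory C] [RigidCategory C] (H) [HopfObj H] [IsIso 𝒮[H]]

/-- Splitting `piRL H` already gives a right integral on `H` and a left integral in `H`. The other
two arise by composing with `piLL H` and `piRR H`; universality follows from absorptions such as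
`piLL H ≫ piRL H = piLL H`. -/
theorem exists_isIntegralObj [IsIdempotentComplete C] :
    ∃ (K : C) (intL intR : H ⟶ K) (cointL cointR : K ⟶ H),
      IsIntegralObj H K intL intR cointL cointR := by
  have hLL := piLL_isProjection H
  have hRL := piRL_isProjection H
  have hRR := piRR_isProjection H
  obtain ⟨K, i, p, hip, hpi⟩ := IsIdempotentComplete.idempotents_split H (piRL H)
    (hRL.comp_of_on _ hRL.on)
  have hp : IsRightIntegralOn p := by
    have h := hRL.on.comp p
    rwa [← hpi, Category.assoc, hip, Category.comp_id] at h
  have hi : IsLeftIntegralIn i := by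
    have h := hRL.mem.precomp i
    rwa [← hpi, reassoc_of% hip] at h
  refine ⟨K, piLL H ≫ p, p, i, i ≫ piRR H, hLL.on.comp p, hp, hi, hRR.mem.precomp i, ?_, ?_, ?_, ?_⟩
  · intro X f hf
    refine ⟨i ≫ f, ?_, fun g hg => ?_⟩
    · simp only [Category.assoc]
      rw [reassoc_of% hpi, reassoc_of% hRL.of_in_comp _ hLL.mem, hLL.comp_of_on f hf]
    · simp only [← hg, Category.assoc]
      rw [reassoc_of% hLL.of_in_comp i hi, reassoc_of% hip]
  · intro X f hf
    refine ⟨i ≫ f, ?_, fun g hg => ?_⟩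
    · simp only []
      rw [reassoc_of% hpi, hRL.comp_of_on f hf]
    · rw [← hg, reassoc_of% hip]
  · intro X f hf
    refine ⟨f ≫ p, ?_, fun g hg => ?_⟩
    · simp only [Category.assoc]
      rw [hpi, hRL.of_in_comp f hf]
    · rw [← hg, Category.assoc, hip, Category.comp_id]
  · intro X f hf
    refine ⟨f ≫ p, ?_, fun g hg => ?_⟩
    · simp only [Category.assoc]
      rw [reassoc_of% hpi, hRL.comp_of_on _ hRR.on, hRR.of_in_comp f hf]
    · simp only [← hg, Category.assoc]
      rw [hRR.comp_of_on p hp, hip, Category.comp_id]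

section Properties

variable {H} {K : C} {intL intR : H ⟶ K} {cointL cointR : K ⟶ H}

lemma IsIntegralObj.exists_inverse_LL (hK : IsIntegralObj H K intL intR cointL cointR) :
    ∃ r : K ⟶ K, (cointL ≫ intL) ≫ r = 𝟙 K ∧
    r ≫ cointL ≫ intL = 𝟙 K ∧ piLL H = intL ≫ r ≫ cointL :=
  (piLL_isProjection H).exists_inverse hK.intL_isIntegral hK.cointL_isIntegral
    hK.intL_universal hK.cointL_universal

lemma IsIntegralObj.exists_inverse_RL (hK : IsIntegralObj H K intL intR cointL cointR) :
    ∃ r : K ⟶ K, (cointL ≫ intR) ≫ r = 𝟙 K ∧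
    r ≫ cointL ≫ intR = 𝟙 K ∧ piRL H = intR ≫ r ≫ cointL :=
  (piRL_isProjection H).exists_inverse hK.intR_isIntegral hK.cointL_isIntegral
    hK.intR_universal hK.cointL_universal

lemma IsIntegralObj.exists_inverse_LR (hK : IsIntegralObj H K intL intR cointL cointR) :
    ∃ r : K ⟶ K, (cointR ≫ intL) ≫ r = 𝟙 K ∧
    r ≫ cointR ≫ intL = 𝟙 K ∧ piLR H = intL ≫ r ≫ cointR :=
  (piLR_isProjection H).exists_inverse hK.intL_isIntegral hK.cointR_isIntegral
    hK.intL_universal hK.cointR_universal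

lemma IsIntegralObj.exists_inverse_RR (hK : IsIntegralObj H K intL intR cointL cointR) :
    ∃ r : K ⟶ K, (cointR ≫ intR) ≫ r = 𝟙 K ∧
    r ≫ cointR ≫ intR = 𝟙 K ∧ piRR H = intR ≫ r ≫ cointR :=
  (piRR_isProjection H).exists_inverse hK.intR_isIntegral hK.cointR_isIntegral
    hK.intR_universal hK.cointR_universal

lemma IsIntegralObj.isInvertibleObj (hK : IsIntegralObj H K intL intR cointL cointR) :
    IsInvertibleObj K := by
  obtain ⟨r, hr, hr', hP⟩ := hK.exists_inverse_LL
  have : IsIso (cointL ≫ intR) :=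
    let ⟨r, hr, hr', _⟩ := hK.exists_inverse_RL
    ⟨r, hr, hr'⟩
  have : IsIso (cointR ≫ intL) :=
    let ⟨r, hr, hr', _⟩ := hK.exists_inverse_LR
    ⟨r, hr, hr'⟩
  have hβ : (cointR ≫ 𝒮[H]) ▷ K ≫ H ◁ (cointL ≫ intL) =
      (β_ K K).hom ≫ cointL ▷ K ≫ H ◁ (cointR ≫ intL) := by
    apply eq_of_tail22
    have h := tail_integrals_exchange hK.cointR_isIntegral hK.cointL_isIntegral
      hK.intL_isIntegral (𝟙_ C)
    calc _ = _ := by simp [tail22]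
      _ = _ := h
      _ = _ := by simp [tail22, br]
  have hβ' : (β_ K K).hom = (cointR ≫ 𝒮[H] ≫ intR ≫ inv (cointL ≫ intR)) ▷ K ≫
      K ◁ ((cointL ≫ intL) ≫ inv (cointR ≫ intL)) := by
    -- Composing with a left inverse of each factor on the right of `hβ` isolates the braiding.
    have h := hβ =≫ ((intR ≫ inv (cointL ≫ intR)) ⊗ₘ inv (cointR ≫ intL))
    have e : cointL ≫ intR ≫ inv (cointL ≫ intR) = 𝟙 K := by
      rw [← Category.assoc, IsIso.hom_inv_id]
    rw [← MonoidalCategory.tensorHom_def, ← MonoidalCategory.tensorHom_def, Category.assoc,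
      tensorHom_comp_tensorHom, tensorHom_comp_tensorHom, e, IsIso.hom_inv_id, id_tensorHom_id,
      Category.comp_id, Category.assoc] at h
    rw [← h, MonoidalCategory.tensorHom_def]
  -- Since `piLL H` factors through `K`, the trace identity factors the identity of the unit through
  -- ᘁH ⊗ K.
  have htr := loop_invAntipode_projTail (ᘁH) H (𝟙_ C)
  rw [← proj_whiskerRight_unit, ← piLL_eq_proj, hP] at htr
  refine isInvertibleObj_of_braiding_eq _ _ hβ'
    (tail02 (η_ (ᘁH) H) (𝟙_ C) ≫ (ᘁH : C) ◁ ((inv 𝒮[H] ≫ intL ≫ r) ▷ 𝟙_ C ≫ (ρ_ K).hom))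
    ((ᘁH : C) ◁ ((ρ_ K).inv ≫ cointL ▷ 𝟙_ C) ≫ tail20 (crossedEval (ᘁH) H) (𝟙_ C)) ?_
  rw [← htr, loop]
  simp

end Properties

end Main

end IntegralObjects
end BraidedIntegral

/-! ### The main theorem -/

theorem mainTheorem3 {C : Type u} [Category.{v} C] [MonoidalCategory C] [BraidedCategory C]
    [RigidCategory C] [IsIdempotentComplete C] (H : C) [HopfObj H] [IsIso 𝒮[H]] :
    -- the object of integrals exists
    (∃ (K : C) (intL intR : H ⟶ K) (cointL cointR : K ⟶ H),
      IsIntegralObj H K intL intR cointL cointR) ∧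
    ∀ (K : C) (intL intR : H ⟶ K) (cointL cointR : K ⟶ H),
      IsIntegralObj H K intL intR cointL cointR →
      IsInvertibleObj K ∧
      -- the composites of integrals on `H` and integrals in `H` are invertible
      (IsIso (cointL ≫ intL) ∧ IsIso (cointR ≫ intL) ∧
        IsIso (cointL ≫ intR) ∧ IsIso (cointR ≫ intR)) ∧
      (∃ cLL cLR cRL cRR : Aut (𝟙_ C),
        -- they are multiples of the identity by invertible scalars
        (cointL ≫ intL = scalar cLL.hom (𝟙 K) ∧ cointR ≫ intL = scalar cLR.hom (𝟙 K) ∧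
          cointL ≫ intR = scalar cRL.hom (𝟙 K) ∧ cointR ≫ intR = scalar cRR.hom (𝟙 K)) ∧
        -- the endomorphisms `Π̌` are the rescaled composites, and this splits them through `K`
        (scalar cRL.inv (intR ≫ cointL) = piRL H ∧
          scalar cLR.inv (intL ≫ cointR) = piLR H ∧
          scalar cLL.inv (intL ≫ cointL) = piLL H ∧
          scalar cRR.inv (intR ≫ cointR) = piRR H) ∧
        (cointL ≫ scalar cRL.inv intR = 𝟙 K ∧ scalar cRL.inv intR ≫ cointL = piRL H) ∧
        (cointR ≫ scalar cLR.inv intL = 𝟙 K ∧ scalar cLR.inv intL ≫ cointR = piLR H) ∧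
        (cointL ≫ scalar cLL.inv intL = 𝟙 K ∧ scalar cLL.inv intL ≫ cointL = piLL H) ∧
        (cointR ≫ scalar cRR.inv intR = 𝟙 K ∧ scalar cRR.inv intR ≫ cointR = piRR H)) ∧
      -- the endomorphisms `Π̌` are idempotents
      (piRL H ≫ piRL H = piRL H ∧ piLR H ≫ piLR H = piLR H ∧
        piLL H ≫ piLL H = piLL H ∧ piRR H ≫ piRR H = piRR H) ∧
      -- they are `H`-valued integrals on `H` and `H`-based integrals in `H`
      (IsRightIntegralOn (piRL H) ∧ IsLeftIntegralIn (piRL H)) ∧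
      (IsLeftIntegralOn (piLR H) ∧ IsRightIntegralIn (piLR H)) ∧
      (IsLeftIntegralOn (piLL H) ∧ IsLeftIntegralIn (piLL H)) ∧
      (IsRightIntegralOn (piRR H) ∧ IsRightIntegralIn (piRR H)) ∧
      -- their traces
      (tr8 (piRL H) = dim8 K ∧ tr8 (piLR H) = dim8 K ∧
        tr8 (piLL H) = dim8 K ∧ tr8 (piRR H) = dim8 K) := by
  refine ⟨exists_isIntegralObj H, fun K intL intR cointL cointR hK => ?_⟩
  have hinv := hK.isInvertibleObj
  obtain ⟨rLL, sLL, sLL', hLL⟩ := hK.exists_inverse_LL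
  obtain ⟨rLR, sLR, sLR', hLR⟩ := hK.exists_inverse_LR
  obtain ⟨rRL, sRL, sRL', hRL⟩ := hK.exists_inverse_RL
  obtain ⟨rRR, sRR, sRR', hRR⟩ := hK.exists_inverse_RR
  have pLL := piLL_isProjection H
  have pLR := piLR_isProjection H
  have pRL := piRL_isProjection H
  have pRR := piRR_isProjection H
  have iLL : IsIso (cointL ≫ intL) := ⟨rLL, sLL, sLL'⟩
  have iLR : IsIso (cointR ≫ intL) := ⟨rLR, sLR, sLR'⟩
  have iRL : IsIso (cointL ≫ intR) := ⟨rRL, sRL, sRL'⟩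
  have iRR : IsIso (cointR ≫ intR) := ⟨rRR, sRR, sRR'⟩
  refine ⟨hinv, ⟨iLL, iLR, iRL, iRR⟩, ?_, ⟨pRL.comp_of_on _ pRL.on, pLR.comp_of_on _ pLR.on,
    pLL.comp_of_on _ pLL.on, pRR.comp_of_on _ pRR.on⟩, ⟨pRL.on, pRL.mem⟩, ⟨pLR.on, pLR.mem⟩,
    ⟨pLL.on, pLL.mem⟩, ⟨pRR.on, pRR.mem⟩, tr8_eq_dim8 sRL hRL, tr8_eq_dim8 sLR hLR,
    tr8_eq_dim8 sLL hLL, tr8_eq_dim8 sRR hRR⟩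
  -- Each composite on `K` is an automorphism of an invertible object, hence a scalar; the factor
  -- `r` in p ≫ r ≫ i is then the inverse scalar.
  obtain ⟨cLL, hcLL⟩ := exists_scalar hinv (cointL ≫ intL)
  obtain ⟨cLR, hcLR⟩ := exists_scalar hinv (cointR ≫ intL)
  obtain ⟨cRL, hcRL⟩ := exists_scalar hinv (cointL ≫ intR)
  obtain ⟨cRR, hcRR⟩ := exists_scalar hinv (cointR ≫ intR)
  obtain ⟨eLL, fLL⟩ := scalar_splitting hcLL sLL hLL
  obtain ⟨eLR, fLR⟩ := scalar_splitting hcLR sLR hLR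
  obtain ⟨eRL, fRL⟩ := scalar_splitting hcRL sRL hRL
  obtain ⟨eRR, fRR⟩ := scalar_splitting hcRR sRR hRR
  refine ⟨cLL, cLR, cRL, cRR, ⟨hcLL, hcLR, hcRL, hcRR⟩, ⟨fRL, fLR, fLL, fRR⟩, ⟨eRL, ?_⟩, ⟨eLR, ?_⟩,
    ⟨eLL, ?_⟩, ⟨eRR, ?_⟩⟩ <;> rwa [scalar_comp]
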